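/- Let $K=\mathbb{Q}(\sqrt{36497})$, let $\overline{\mathbb{Q}}$ be an algebraic closure of $\mathbb{Q}$ containing $K$, and for a subfield $k\subset\overline{\mathbb{Q}}$ let $\Gamma_k=\mathrm{Gal}(\overline{\mathbb{Q}}/k)$ act entrywise on $GL_n(\overline{\mathbb{Q}})$. For a subgroup $G$ of $GL_n(\overline{\mathbb{Q}})$, the field of definition of $G$ over $k$ is the smallest Galois extension $N/k$ inside $\overline{\mathbb{Q}}$ with $G\subseteq GL_n(N)$. Then: 1. $K$ has class number $1$, and there is a totally real finite Galois extension $L/K$ inside $\overline{\mathbb{Q}}$, unramified at all finite and infinite places, with $\mathrm{Gal}(L/K)\cong A_5$. 2. Let $L$ be any extension as in 1. Then $O_L$ is a free $O_K$-module of rank $60$ and $L$ has exactly $60$ embeddings into $\overline{\mathbb{Q}}$ over $K$. Let $u_1,\dots,u_{60}$ be any basis of $O_L$ over $O_K$, let $\tau_1,\dots,\tau_{60}$ be the embeddings $L\hookrightarrow\overline{\mathbb{Q}}$ over $K$ in any order, and let $U=(\tau_i(u_j))_{i,j}$, an invertible matrix. Let $p$ be any prime number, $\xi_p\in\overline{\mathbb{Q}}$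 a primitive $p$-th root of unity, $P$ the group of all diagonal matrices $w\in GL_{60}(\overline{\mathbb{Q}})$ with $w^p=1$, and $P_U=U^{-1}PU$. Then $P_U$ is a finite $\Gamma_K$-stable subgroup of $GL_{60}(O_{L(\xi_p)})$; its field of definition over $K$ is $L(\xi_p)$, which is not an abelian extension of $K$. Moreover $P_U$ is $\Gamma_{K(\xi_p)}$-stable, its field of definition over $K(\xi_p)$ is $L(\xi_p)$, and $\mathrm{Gal}(L(\xi_p)/K(\xi_p))\cong A_5$. In particular, the question of Kitaoka and Suzuki, whether the field of definition of a finite $\Gamma_K$-stable subgroup of $GL_n(O_{\overline{\mathbb{Q}}})$ ($O_{\overline{\mathbb{Q}}}$ the ring of all algebraic integers) is always abelian over the number field $K$, has a negative answer, and the Galois group of the field of definition can be a nonabelian simple group. -/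

import Mathlib

open scoped NumberField

noncomputable section

namespace StableGL

/-- A fixed algebraic closure of `ℚ`. -/
abbrev Qbar : Type := AlgebraicClosure ℚ

instance Qbar_isAlgebraic : Algebra.IsAlgebraic ℚ Qbar := AlgebraicClosure.isAlgebraic ℚ

/-! ### The base field -/

/-- The real quadratic field `ℚ(√36497)`, generated by the two square roots of `36497`. -/
def quadField : IntermediateField ℚ Qbar :=
  IntermediateField.adjoin ℚ {x : Qbar | x ^ 2 = 36497}

instance quadField_finiteDimensional : FiniteDimensional ℚ quadField := by
  have hfin : {x : Qbar | x ^ 2 = 36497}.Finite := by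
    classical
    refine (Polynomial.nthRoots 2 (36497 : Qbar)).toFinset.finite_toSet.subset fun x hx => ?_
    simpa [Polynomial.mem_nthRoots two_pos] using hx
  have : Finite {x : Qbar | x ^ 2 = 36497} := hfin
  exact IntermediateField.finiteDimensional_adjoin fun x _ =>
    (Algebra.IsAlgebraic.isAlgebraic (R := ℚ) x).isIntegral

instance quadField_numberField : NumberField quadField where

/-! ### Unramified extensions -/

/-- `L / k` is unramified at every place: every nonzero prime ideal of `𝓞 L` has ramification
index one over `𝓞 k`, and every infinite place of `L` is unramified over `k`. -/
structure IsEverywhereUnramified (k L : Type*) [Field k] [Field L] [Algebra k L] : Prop where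
  finite_places : ∀ P : Ideal (𝓞 L), P.IsPrime → P ≠ ⊥ → P.ramificationIdx (𝓞 k) = 1
  infinite_places : IsUnramifiedAtInfinitePlaces k L

/-- `L / k` is a finite Galois extension with group `A₅`, everywhere unramified, and `L` is
totally real. -/
structure IsUnramifiedTotallyRealA5 (k L : Type*) [Field k] [Field L] [Algebra k L] : Prop where
  finiteDimensional : FiniteDimensional k L
  isGalois : IsGalois k L
  gal_equiv : Nonempty (Gal(L/k) ≃* alternatingGroup (Fin 5))
  unramified : IsEverywhereUnramified k L
  totallyReal : NumberField.IsTotallyReal L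

/-! ### Subgroups of `GL_n(Qbar)`, Galois stability, field of definition -/

section FieldOfDefinition

variable {n : ℕ} (k : Type*) [Field k] [Algebra k Qbar]

/-- `G` is stable under the absolute Galois group `Γ_k` acting entrywise. -/
def IsGaloisStable (G : Subgroup (GL (Fin n) Qbar)) : Prop :=
  ∀ σ : Gal(Qbar/k), G.map (Matrix.GeneralLinearGroup.map (σ : Qbar →+* Qbar)) = G

variable {k}

/-- `GL_n(F)` as a subgroup of `GL_n(Qbar)`. -/
def glField (n : ℕ) (F : IntermediateField k Qbar) : Subgroup (GL (Fin n) Qbar) :=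
  (Matrix.GeneralLinearGroup.map (algebraMap F Qbar)).range

/-- `GL_n(O_F)` as a subgroup of `GL_n(Qbar)`. -/
def glIntegers (n : ℕ) (F : IntermediateField k Qbar) : Subgroup (GL (Fin n) Qbar) :=
  (Matrix.GeneralLinearGroup.map ((algebraMap F Qbar).comp (algebraMap (𝓞 F) F))).range

variable (k)

/-- `N` is the field of definition of `G` over `k`: the smallest Galois extension of `k` inside
`Qbar` over which all elements of `G` are defined. -/
def IsFieldOfDefinition (G : Subgroup (GL (Fin n) Qbar)) (N : IntermediateField k Qbar) : Prop :=
  IsLeast {F : IntermediateField k Qbar | IsGalois k F ∧ G ≤ glField n F} N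

end FieldOfDefinition

/-! ### The construction `U⁻¹ P U` -/

/-- The maximal elementary abelian `p`-subgroup `P` of the group of diagonal matrices in
`GL_n(Qbar)`: all invertible diagonal matrices `w` with `w ^ p = 1`. -/
def diagTorsion (n p : ℕ) : Subgroup (GL (Fin n) Qbar) :=
  ((rootsOfUnity p (Fin n → Qbar)).map
    (Units.map (Matrix.diagonalRingHom (Fin n) Qbar : (Fin n → Qbar) →* Matrix (Fin n) (Fin n) Qbar)))

theorem mem_diagTorsion {n p : ℕ} {g : GL (Fin n) Qbar} :
    g ∈ diagTorsion n p ↔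
      (g : Matrix (Fin n) (Fin n) Qbar).IsDiag ∧ g ^ p = 1 := by
  constructor
  · rintro ⟨d, hd, rfl⟩
    refine ⟨Matrix.isDiag_diagonal _, ?_⟩
    have hd' : d ^ p = 1 := hd
    rw [← map_pow, hd', map_one]
  · rintro ⟨hdiag, hp⟩
    obtain ⟨d, hd⟩ : ∃ d, Matrix.diagonal d = (g : Matrix (Fin n) (Fin n) Qbar) :=
      ⟨_, hdiag.diagonal_diag⟩
    have hu : IsUnit d := by
      have := g.isUnit
      rw [← hd] at this
      exact Matrix.isUnit_diagonal.mp this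
    refine ⟨hu.unit, ?_, Units.ext hd⟩
    change hu.unit ^ p = 1
    have h1 : Matrix.diagonal (d ^ p) = Matrix.diagonal (1 : Fin n → Qbar) := by
      rw [← Matrix.diagonal_pow, hd, ← Units.val_pow_eq_pow_val, hp]
      exact Matrix.diagonal_one.symm
    exact Units.ext (Matrix.diagonal_injective h1)

section Construction

variable {n : ℕ} {k : Type*} [Field k] [Algebra k Qbar] {L : IntermediateField k Qbar}

theorem det_embeddingMatrix_ne_zero [CharZero k] (u : Module.Basis (Fin n) k L)
    (τ : Fin n ≃ (L →ₐ[k] Qbar)) :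
    (Matrix.of fun i j => τ i (u j) : Matrix (Fin n) (Fin n) Qbar).det ≠ 0 := by
  have : FiniteDimensional k L := Module.Basis.finiteDimensional_of_finite u
  have h := Algebra.discr_eq_det_embeddingsMatrixReindex_pow_two k Qbar (u : Fin n → L) τ
  have ht : (Matrix.of fun i j => τ i (u j) : Matrix (Fin n) (Fin n) Qbar) =
      (Algebra.embeddingsMatrixReindex k Qbar (u : Fin n → L) τ).transpose := by
    ext i j
    simp [Algebra.embeddingsMatrixReindex, Algebra.embeddingsMatrix]
  rw [ht, Matrix.det_transpose]
  intro h0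
  rw [h0, zero_pow two_ne_zero] at h
  exact Algebra.discr_not_zero_of_basis k u ((map_eq_zero _).mp h)

/-- The invertible matrix `U` with entries `U i j = τ i (u j)`, where `u` is a basis of `L / k` and
`τ` lists the `k`-embeddings of `L` into `Qbar`. -/
def embeddingGL [CharZero k] (u : Module.Basis (Fin n) k L) (τ : Fin n ≃ (L →ₐ[k] Qbar)) :
    GL (Fin n) Qbar :=
  Matrix.GeneralLinearGroup.mkOfDetNeZero (Matrix.of fun i j => τ i (u j))
    (det_embeddingMatrix_ne_zero u τ)

/-- The group `P_U = U⁻¹ P U`. -/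
def conjDiagTorsion (p : ℕ) (U : GL (Fin n) Qbar) : Subgroup (GL (Fin n) Qbar) :=
  (diagTorsion n p).map (MulAut.conj U⁻¹).toMonoidHom

end Construction

section Integral

variable {n : ℕ} {K : IntermediateField ℚ Qbar} [NumberField K]
  {L : IntermediateField K Qbar}

theorem isLocalization_integers :
    IsLocalization (Algebra.algebraMapSubmonoid (𝓞 L) (nonZeroDivisors (𝓞 K))) L := by
  have h1 : Algebra.IsAlgebraic K Qbar := Algebra.IsAlgebraic.tower_top (K := ℚ) K
  have h2 : Algebra.IsAlgebraic K L := inferInstance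
  exact IsIntegralClosure.isLocalization (𝓞 K) K L (𝓞 L)

/-- An `𝓞 K`-basis of `𝓞 L`, viewed as a `K`-basis of `L`. -/
def integralBasisToField (u : Module.Basis (Fin n) (𝓞 K) (𝓞 L)) : Module.Basis (Fin n) K L :=
  haveI : IsLocalization (Algebra.algebraMapSubmonoid (𝓞 L) (nonZeroDivisors (𝓞 K))) L :=
    isLocalization_integers
  u.localizationLocalization K (nonZeroDivisors (𝓞 K)) L

theorem integralBasisToField_apply (u : Module.Basis (Fin n) (𝓞 K) (𝓞 L)) (i : Fin n) :
    integralBasisToField u i = (u i : L) := by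
  simp [integralBasisToField]

end Integral

/-! ### Adjoining a root of unity -/

section Adjoin

variable {K : IntermediateField ℚ Qbar}

/-- `K(ξ)`. -/
def adjoinRoot (K : IntermediateField ℚ Qbar) (ξ : Qbar) : IntermediateField K Qbar :=
  IntermediateField.adjoin K {ξ}

/-- `L(ξ)`, as an extension of `K`. -/
def compositum (L : IntermediateField K Qbar) (ξ : Qbar) : IntermediateField K Qbar :=
  L ⊔ adjoinRoot K ξ

/-- `L(ξ)`, as an extension of `K(ξ)`. -/
def compositumOver (L : IntermediateField K Qbar) (ξ : Qbar) :
    IntermediateField (adjoinRoot K ξ) Qbar :=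
  IntermediateField.extendScalars (show adjoinRoot K ξ ≤ compositum L ξ from le_sup_right)

end Adjoin

end StableGL

end

/-!
Write `K = ℚ(√36497)`.

The extension `L` is the splitting field of `f = X⁵ - 2X⁴ - 3X³ + 5X² + X - 1`, which has five real
roots and discriminant `36497`, a prime. Modulo a prime ideal `f` has at most one double root and no
triple root (`IsRootList.double_root`, `IsRootList.no_triple_root`), so every inertia group acts on
the roots through the identity or a transposition (`rootPerm_of_mem_inertia`). Since `ℚ` has no
unramified extension, some inertia group over `ℚ` is nontrivial and gives a transposition; as `f`
is irreducible modulo `2`, the Galois group over `ℚ` has order divisible by `5` and is therefore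
`S₅` (`rootPerm_surjective`). The field `K` is generated by the square root of the discriminant, so
`Gal(L/K)` is `A₅`, and its inertia groups are trivial because transpositions are odd
(`isUnramifiedTotallyRealA5_of_isRootList`). The class number of `K` is one since explicit
generators exist for all prime ideals of degree one below the Minkowski bound (`exists_generator`).

For an arbitrary unramified `L` with group `A₅`, the different is trivial, so the trace-dual `y` of
an integral basis `u` is integral. The inverse of `U = (τ_i (u_j))` is the matrix `(τ_j (y_i))`, and
`U⁻¹ P U` consists of matrices over the integers of `L(ξ)` (`entries_mem`). An automorphism `σ` of
`Qbar` over `K` permutes the rows of `U`, so it maps `U⁻¹ w U` to `U⁻¹ w' U`, where `w'` is `σ(w)`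
with permuted entries (`map_mul_eq_diagonal_mul`). This gives stability. If `σ` fixes `U⁻¹ w U` for
the `w` whose only entry different from `1` is `ξ`, at the place of the inclusion `L ⊆ Qbar`, then
it fixes that embedding as well as `ξ`, that is, it fixes `L(ξ)` (`fixes_of_forall_map_eq`). By the
Galois correspondence `L(ξ)` is the field of definition, over `K` and over `K(ξ)`. Finally, `A₅` is
perfect and commutators in the Galois group of `K` fix `ξ`, so the Galois group of `K(ξ)` maps onto
`Gal(L/K)` (`restrict_surjective`), and `Gal(L(ξ)/K(ξ))` is `A₅` too.
-/

noncomputable section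

namespace StableGL

section Arithmetic

open Polynomial

/-! ### The quintic and its discriminant -/

/-- The quintic `X⁵ - 2X⁴ - 3X³ + 5X² + X - 1`, of prime discriminant `36497`. -/
def quintic : ℤ[X] := X ^ 5 - 2 * X ^ 4 - 3 * X ^ 3 + 5 * X ^ 2 + X - 1

theorem quintic_monic : quintic.Monic := by
  unfold quintic; monicity!

theorem quintic_natDegree : quintic.natDegree = 5 := by
  unfold quintic; compute_degree!

/-- `v` lists the roots of the quintic in `R`, with multiplicity. -/
def IsRootList {R : Type*} [CommRing R] (v : Fin 5 → R) : Prop :=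
  ∏ i, (X - C (v i)) = quintic.map (Int.castRingHom R)

theorem map_quintic (R : Type*) [CommRing R] : quintic.map (Int.castRingHom R) =
    X ^ 5 - 2 * X ^ 4 - 3 * X ^ 3 + 5 * X ^ 2 + X - 1 := by
  simp [quintic, Polynomial.map_ofNat]

namespace IsRootList

variable {R : Type*} [CommRing R] {v : Fin 5 → R}

theorem map {S : Type*} [CommRing S] (hv : IsRootList v) (φ : R →+* S) :
    IsRootList (fun i => φ (v i)) := by
  have h := congrArg (Polynomial.map φ) hv
  rw [Polynomial.map_map, RingHom.ext_int (φ.comp (Int.castRingHom R)) (Int.castRingHom S)] at h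
  rw [IsRootList, ← h, Polynomial.map_prod]
  simp

theorem of_map {S : Type*} [CommRing S] (φ : R →+* S) (hφ : Function.Injective φ)
    (hv : IsRootList (fun i => φ (v i))) : IsRootList v := by
  apply Polynomial.map_injective φ hφ
  rw [Polynomial.map_map, RingHom.ext_int (φ.comp (Int.castRingHom R)) (Int.castRingHom S), ← hv,
    Polynomial.map_prod]
  simp

theorem eval_eq (hv : IsRootList v) (i : Fin 5) :
    v i ^ 5 - 2 * v i ^ 4 - 3 * v i ^ 3 + 5 * v i ^ 2 + v i - 1 = 0 := by
  have h := congrArg (Polynomial.eval (v i)) hv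
  rw [map_quintic, Polynomial.eval_prod, Finset.prod_eq_zero (Finset.mem_univ i) (by simp)] at h
  simpa using h.symm

/-- Vieta's relations for the quintic. -/
theorem vieta (hv : IsRootList v) :
    v 0 + v 1 + v 2 + v 3 + v 4 = 2 ∧
    v 0 * v 1 + v 0 * v 2 + v 0 * v 3 + v 0 * v 4 + v 1 * v 2 + v 1 * v 3 + v 1 * v 4 +
      v 2 * v 3 + v 2 * v 4 + v 3 * v 4 = -3 ∧
    v 0 * v 1 * v 2 + v 0 * v 1 * v 3 + v 0 * v 1 * v 4 + v 0 * v 2 * v 3 + v 0 * v 2 * v 4 +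
      v 0 * v 3 * v 4 + v 1 * v 2 * v 3 + v 1 * v 2 * v 4 + v 1 * v 3 * v 4 +
      v 2 * v 3 * v 4 = -5 ∧
    v 0 * v 1 * v 2 * v 3 + v 0 * v 1 * v 2 * v 4 + v 0 * v 1 * v 3 * v 4 + v 0 * v 2 * v 3 * v 4 +
      v 1 * v 2 * v 3 * v 4 = 1 ∧
    v 0 * v 1 * v 2 * v 3 * v 4 = 1 := by
  have key : ∀ a b c d e : R, (X - C a) * (X - C b) * (X - C c) * (X - C d) * (X - C e) =
      X ^ 5 - C (a + b + c + d + e) * X ^ 4 +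
      C (a * b + a * c + a * d + a * e + b * c + b * d + b * e + c * d + c * e + d * e) * X ^ 3 -
      C (a * b * c + a * b * d + a * b * e + a * c * d + a * c * e + a * d * e + b * c * d +
        b * c * e + b * d * e + c * d * e) * X ^ 2 +
      C (a * b * c * d + a * b * c * e + a * b * d * e + a * c * d * e + b * c * d * e) * X -
      C (a * b * c * d * e) := by
    intros; simp only [map_add, map_mul]; ring
  have h := hv
  rw [IsRootList, Fin.prod_univ_five, key, map_quintic] at h
  have h2 : (X ^ 5 - 2 * X ^ 4 - 3 * X ^ 3 + 5 * X ^ 2 + X - 1 : R[X]) =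
    X ^ 5 - C 2 * X ^ 4 - C 3 * X ^ 3 + C 5 * X ^ 2 + X - C 1 := by
    simp only [map_ofNat, map_one]
  rw [h2] at h
  have c0 := congrArg (fun p => coeff p 0) h
  have c1 := congrArg (fun p => coeff p 1) h
  have c2 := congrArg (fun p => coeff p 2) h
  have c3 := congrArg (fun p => coeff p 3) h
  have c4 := congrArg (fun p => coeff p 4) h
  simp only [coeff_sub, coeff_add, coeff_C_mul, coeff_X_pow, coeff_X, coeff_C] at c0 c1 c2 c3 c4
  norm_num at c0 c1 c2 c3 c4
  refine ⟨?_, ?_, ?_, ?_, ?_⟩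
  · linear_combination -c4
  · linear_combination c3
  · linear_combination -c2
  · linear_combination c1
  · linear_combination c0

/-- Power sums of the roots, from Newton's identities and the recursion `f (v i) = 0`. -/
theorem powerSum (hv : IsRootList v) (k : Fin 9) :
    ∑ i, v i ^ (k : ℕ) = ((![5, 2, 10, 11, 38, 62, 175, 345, 878] k : ℤ) : R) := by
  obtain ⟨e1, e2, e3, e4, e5⟩ := hv.vieta
  have r0 := hv.eval_eq 0
  have r1 := hv.eval_eq 1
  have r2 := hv.eval_eq 2
  have r3 := hv.eval_eq 3
  have r4 := hv.eval_eq 4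
  rw [Fin.sum_univ_five]
  generalize v 0 = a, v 1 = b, v 2 = c, v 3 = d, v 4 = e at *
  have p1 : a + b + c + d + e = 2 := e1
  have p2 : a ^ 2 + b ^ 2 + c ^ 2 + d ^ 2 + e ^ 2 = 10 := by
    linear_combination (a + b + c + d + e + 2) * e1 - 2 * e2
  have p3 : a ^ 3 + b ^ 3 + c ^ 3 + d ^ 3 + e ^ 3 = 11 := by
    linear_combination 10 * e1 + (a + b + c + d + e) * p2 - 2 * e2 -
      (a * b + a * c + a * d + a * e + b * c + b * d + b * e + c * d + c * e + d * e) * p1 + 3 * e3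
  have p4 : a ^ 4 + b ^ 4 + c ^ 4 + d ^ 4 + e ^ 4 = 38 := by
    linear_combination 11 * e1 + (a + b + c + d + e) * p3 - 10 * e2 -
      (a * b + a * c + a * d + a * e + b * c + b * d + b * e + c * d + c * e + d * e) * p2 +
      2 * e3 + (a * b * c + a * b * d + a * b * e + a * c * d + a * c * e + a * d * e + b * c * d +
        b * c * e + b * d * e + c * d * e) * p1 - 4 * e4
  have p5 : a ^ 5 + b ^ 5 + c ^ 5 + d ^ 5 + e ^ 5 = 62 := by
    linear_combination r0 + r1 + r2 + r3 + r4 + 2 * p4 + 3 * p3 - 5 * p2 - p1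
  have p6 : a ^ 6 + b ^ 6 + c ^ 6 + d ^ 6 + e ^ 6 = 175 := by
    linear_combination a * r0 + b * r1 + c * r2 + d * r3 + e * r4 + 2 * p5 + 3 * p4 - 5 * p3 -
      p2 + p1
  have p7 : a ^ 7 + b ^ 7 + c ^ 7 + d ^ 7 + e ^ 7 = 345 := by
    linear_combination a ^ 2 * r0 + b ^ 2 * r1 + c ^ 2 * r2 + d ^ 2 * r3 + e ^ 2 * r4 + 2 * p6 +
      3 * p5 - 5 * p4 - p3 + p2
  have p8 : a ^ 8 + b ^ 8 + c ^ 8 + d ^ 8 + e ^ 8 = 878 := by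
    linear_combination a ^ 3 * r0 + b ^ 3 * r1 + c ^ 3 * r2 + d ^ 3 * r3 + e ^ 3 * r4 + 2 * p7 +
      3 * p6 - 5 * p5 - p4 + p3
  fin_cases k <;> simp <;> first | assumption | norm_num

/-- The Vandermonde determinant of the roots is a square root of the discriminant `36497`. -/
theorem det_vandermonde_sq (hv : IsRootList v) : (Matrix.vandermonde v).det ^ 2 = 36497 := by
  -- The Gram matrix of the Vandermonde matrix has the power sums as entries.
  have h : (Matrix.vandermonde v).transpose * Matrix.vandermonde v =
      (!![5, 2, 10, 11, 38; 2, 10, 11, 38, 62; 10, 11, 38, 62, 175; 11, 38, 62, 175, 345;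
        38, 62, 175, 345, 878] : Matrix (Fin 5) (Fin 5) ℤ).map (Int.castRingHom R) := by
    ext i j
    have hp := hv.powerSum ⟨(i : ℕ) + j, by omega⟩
    simp only [Matrix.mul_apply, Matrix.transpose_apply, Matrix.vandermonde_apply, ← pow_add]
    rw [hp]
    fin_cases i <;> fin_cases j <;> rfl
  have h2 := congrArg Matrix.det h
  rw [Matrix.det_mul, Matrix.det_transpose, ← sq, ← RingHom.mapMatrix_apply,
    ← RingHom.map_det] at h2
  have hd : (!![5, 2, 10, 11, 38; 2, 10, 11, 38, 62; 10, 11, 38, 62, 175; 11, 38, 62, 175, 345;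
        38, 62, 175, 345, 878] : Matrix (Fin 5) (Fin 5) ℤ).det = 36497 := by
    simp [Matrix.det_succ_row_zero, Fin.sum_univ_succ, Fin.succAbove]
  rw [h2, hd]
  simp

/-- Two coinciding roots form a double root, which satisfies `f' = 0`; by the Bézout relations
between `f` and `f'` this happens only in characteristic `36497`, at `9466`. -/
theorem double_root (hv : IsRootList v) {i j : Fin 5} (hij : i ≠ j) (h : v i = v j) :
    (36497 : R) = 0 ∧ v i = 9466 := by
  have h0 := hv.eval_eq i
  have hd := hv
  rw [IsRootList, ← Finset.mul_prod_erase _ _ (Finset.mem_univ i),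
    ← Finset.mul_prod_erase _ _ (Finset.mem_erase.2 ⟨hij.symm, Finset.mem_univ j⟩), ← h,
    map_quintic] at hd
  have h1 := congrArg (fun p => eval (v i) (derivative p)) hd
  simp [derivative_pow] at h1
  generalize v i = a at *
  constructor
  · linear_combination (-29402 + 62534 * a + 39705 * a ^ 2 - 33950 * a ^ 3) * h0 -
      (7095 + 20986 * a - 21824 * a ^ 2 - 10657 * a ^ 3 + 6790 * a ^ 4) * h1
  · have hq : (36497 : R) = 0 := by
      linear_combination (-29402 + 62534 * a + 39705 * a ^ 2 - 33950 * a ^ 3) * h0 -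
        (7095 + 20986 * a - 21824 * a ^ 2 - 10657 * a ^ 3 + 6790 * a ^ 4) * h1
    linear_combination (10568 - 15437 * a + 14808 * a ^ 2) * h0 -
      (1102 - 527 * a - 7407 * a ^ 2 - 10261 * a ^ 3) * h1 -
      (a - 5 * a ^ 3 + 2 * a ^ 4 + 4 * a ^ 5 - a ^ 7) * hq

/-- The quintic has no triple root in any nontrivial ring, as `f''(9466)` is prime to `36497`. -/
theorem no_triple_root [Nontrivial R] (hv : IsRootList v) {i j l : Fin 5} (hij : i ≠ j)
    (hil : i ≠ l) (hjl : j ≠ l) (h : v i = v j) (h' : v i = v l) : False := by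
  obtain ⟨hq, hr⟩ := hv.double_root hij h
  have hd := hv
  rw [IsRootList, ← Finset.mul_prod_erase _ _ (Finset.mem_univ i),
    ← Finset.mul_prod_erase _ _ (Finset.mem_erase.2 ⟨hij.symm, Finset.mem_univ j⟩),
    ← Finset.mul_prod_erase _ _ (Finset.mem_erase.2 ⟨hjl.symm, Finset.mem_erase.2
      ⟨hil.symm, Finset.mem_univ l⟩⟩), ← h, ← h', map_quintic] at hd
  have h2 := congrArg (fun p => eval (v i) (derivative (derivative p))) hd
  simp [derivative_pow] at h2
  rw [hr] at h2
  -- `17218` inverts `f''(9466)` modulo `36497`.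
  apply one_ne_zero (α := R)
  linear_combination -17218 * h2 + (-8002026197179) * hq

/-- At most one pair of roots coincides, so that a permutation preserving the values of `v` is
trivial or a transposition. -/
theorem eq_one_or_isSwap [Nontrivial R] (hv : IsRootList v) (σ : Equiv.Perm (Fin 5))
    (hσ : ∀ i, v (σ i) = v i) : σ = 1 ∨ σ.IsSwap := by
  rw [or_iff_not_imp_left]
  intro h1
  obtain ⟨i, hi⟩ : ∃ i, σ i ≠ i := by
    by_contra! h
    exact h1 (Equiv.ext h)
  have hmem : ∀ j, σ j ≠ j → j = i ∨ j = σ i := by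
    intro j hj
    by_contra! hne
    have hij : v i = v j :=
      (hv.double_root hi.symm (hσ i).symm).2.trans (hv.double_root hj.symm (hσ j).symm).2.symm
    exact hv.no_triple_root hi.symm hne.1.symm hne.2.symm (hσ i).symm hij
  have hi2 : σ (σ i) = i := (hmem (σ (σ i)) fun h => hi (σ.injective (σ.injective h))).resolve_right
    fun h => hi (σ.injective h)
  refine ⟨i, σ i, hi.symm, Equiv.ext fun z => ?_⟩
  by_cases hz : z = i
  · rw [hz, Equiv.swap_apply_left]
  by_cases hz' : z = σ i
  · rw [hz', Equiv.swap_apply_right, hi2]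
  · rw [Equiv.swap_apply_of_ne_of_ne hz hz']
    by_contra h
    exact (hmem z h).elim hz hz'

end IsRootList

/-! ### Irreducibility and roots of the quintic -/

/-- A factorization over `𝔽₂` would have degrees `4 + 1` or `3 + 2`; in both cases the equations
between coefficients have no solution in `𝔽₂`. -/
theorem quintic_irreducible_zmod_two : Irreducible (quintic.map (Int.castRingHom (ZMod 2))) := by
  have hm : (quintic.map (Int.castRingHom (ZMod 2))).Monic := quintic_monic.map _
  have hd : (quintic.map (Int.castRingHom (ZMod 2))).natDegree = 5 := by
    rw [quintic_monic.natDegree_map, quintic_natDegree]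
  rw [hm.irreducible_iff_natDegree']
  refine ⟨fun h => by simp [h] at hd, fun g h hg hh hgh hmem => ?_⟩
  have hdeg : g.natDegree + h.natDegree = 5 := by rw [← hg.natDegree_mul hh, hgh, hd]
  rw [hd, Finset.mem_Ioc] at hmem
  have e (n : ℕ) : (g * h).coeff n = (quintic.coeff n : ZMod 2) := by rw [hgh]; simp
  have e0 := e 0
  have e1 := e 1
  have e2 := e 2
  have e3 := e 3
  have e4 := e 4
  simp only [coeff_mul, Finset.Nat.antidiagonal_succ, quintic, coeff_sub, coeff_add,
    coeff_X_pow, coeff_X, coeff_one] at e0 e1 e2 e3 e4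
  simp at e0 e1 e2 e3 e4
  have hcg := hg.coeff_natDegree
  have hch := hh.coeff_natDegree
  obtain hd2 | hd2 : h.natDegree = 1 ∨ h.natDegree = 2 := by omega
  · have hd1 : g.natDegree = 4 := by omega
    rw [hd1] at hcg
    rw [hd2] at hch
    have h2 : h.coeff 2 = 0 := coeff_eq_zero_of_natDegree_lt (by omega)
    have h3 : h.coeff 3 = 0 := coeff_eq_zero_of_natDegree_lt (by omega)
    have h4 : h.coeff 4 = 0 := coeff_eq_zero_of_natDegree_lt (by omega)
    rw [h2, h3, h4, hch, hcg] at e4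
    rw [h2, h3, hch] at e3
    rw [h2, hch] at e2
    rw [hch] at e1
    generalize g.coeff 0 = a0, g.coeff 1 = a1, g.coeff 2 = a2, g.coeff 3 = a3, h.coeff 0 = b0 at *
    clear * - e0 e1 e2 e3 e4
    revert a0 a1 a2 a3 b0
    decide
  · have hd1 : g.natDegree = 3 := by omega
    rw [hd1] at hcg
    rw [hd2] at hch
    have g4 : g.coeff 4 = 0 := coeff_eq_zero_of_natDegree_lt (by omega)
    have h3 : h.coeff 3 = 0 := coeff_eq_zero_of_natDegree_lt (by omega)
    have h4 : h.coeff 4 = 0 := coeff_eq_zero_of_natDegree_lt (by omega)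
    rw [g4, h3, h4, hch, hcg] at e4
    rw [h3, hch, hcg] at e3
    rw [hch] at e2
    generalize g.coeff 0 = a0, g.coeff 1 = a1, g.coeff 2 = a2, h.coeff 0 = b0, h.coeff 1 = b1 at *
    clear * - e0 e1 e2 e3 e4
    revert a0 a1 a2 b0 b1
    decide

theorem quintic_irreducible_rat : Irreducible (quintic.map (Int.castRingHom ℚ)) :=
  (IsPrimitive.Int.irreducible_iff_irreducible_map_cast quintic_monic.isPrimitive).mp
    (quintic_monic.irreducible_of_irreducible_map _ _ quintic_irreducible_zmod_two)

theorem exists_isRootList_of_isAlgClosed (F : Type*) [Field F] [IsAlgClosed F] :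
    ∃ v : Fin 5 → F, IsRootList v := by
  have hs := IsAlgClosed.splits (quintic.map (Int.castRingHom F))
  have hm : (quintic.map (Int.castRingHom F)).Monic := quintic_monic.map _
  have h1 := hs.eq_prod_roots_of_monic hm
  have h2 := hs.natDegree_eq_card_roots
  rw [quintic_monic.natDegree_map, quintic_natDegree] at h2
  generalize (quintic.map (Int.castRingHom F)).roots = m at h1 h2
  obtain ⟨l, rfl⟩ := Quot.exists_rep m
  change 5 = l.length at h2
  refine ⟨fun i => l.get (i.cast h2), ?_⟩
  rw [IsRootList, h1]
  change _ = (Multiset.map (fun a => X - C a) (l : Multiset F)).prod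
  rw [Multiset.map_coe, Multiset.prod_coe, ← List.prod_ofFn]
  congr 1
  refine List.ext_get (by simp only [List.length_ofFn, List.length_map, h2]) fun n _ _ => ?_
  simp only [List.get_eq_getElem, List.getElem_ofFn, List.getElem_map, Fin.val_cast]

/-- The quintic changes sign between consecutive integers from `-2` to `3`, so it has five real
roots. -/
theorem exists_isRootList_real : ∃ r : Fin 5 → ℝ, IsRootList r := by
  have hcont : Continuous fun x : ℝ => x ^ 5 - 2 * x ^ 4 - 3 * x ^ 3 + 5 * x ^ 2 + x - 1 := by
    fun_prop
  obtain ⟨a, ha, ha0⟩ := intermediate_value_Icc (show (-2 : ℝ) ≤ -1 by norm_num)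
    hcont.continuousOn (show (0 : ℝ) ∈ Set.Icc _ _ by norm_num)
  obtain ⟨b, hb, hb0⟩ := intermediate_value_Icc' (show (-1 : ℝ) ≤ 0 by norm_num)
    hcont.continuousOn (show (0 : ℝ) ∈ Set.Icc _ _ by norm_num)
  obtain ⟨c, hc, hc0⟩ := intermediate_value_Icc (show (0 : ℝ) ≤ 1 by norm_num)
    hcont.continuousOn (show (0 : ℝ) ∈ Set.Icc _ _ by norm_num)
  obtain ⟨d, hd, hd0⟩ := intermediate_value_Icc' (show (1 : ℝ) ≤ 2 by norm_num)
    hcont.continuousOn (show (0 : ℝ) ∈ Set.Icc _ _ by norm_num)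
  obtain ⟨e, he, he0⟩ := intermediate_value_Icc (show (2 : ℝ) ≤ 3 by norm_num)
    hcont.continuousOn (show (0 : ℝ) ∈ Set.Icc _ _ by norm_num)
  dsimp only at ha0 hb0 hc0 hd0 he0
  have hab : a < b := by
    refine lt_of_le_of_ne (ha.2.trans hb.1) fun h => ?_
    have : a = -1 := le_antisymm ha.2 (h ▸ hb.1)
    rw [this] at ha0; norm_num at ha0
  have hbc : b < c := by
    refine lt_of_le_of_ne (hb.2.trans hc.1) fun h => ?_
    have : b = 0 := le_antisymm hb.2 (h ▸ hc.1)
    rw [this] at hb0; norm_num at hb0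
  have hcd : c < d := by
    refine lt_of_le_of_ne (hc.2.trans hd.1) fun h => ?_
    have : c = 1 := le_antisymm hc.2 (h ▸ hd.1)
    rw [this] at hc0; norm_num at hc0
  have hde : d < e := by
    refine lt_of_le_of_ne (hd.2.trans he.1) fun h => ?_
    have : d = 2 := le_antisymm hd.2 (h ▸ he.1)
    rw [this] at hd0; norm_num at hd0
  have hinj : Function.Injective ![a, b, c, d, e] := by
    refine (Fin.strictMono_iff_lt_succ.2 fun i => ?_).injective
    fin_cases i <;> simpa
  refine ⟨![a, b, c, d, e], ?_⟩
  have hdvd : ∏ i, (X - C (![a, b, c, d, e] i)) ∣ quintic.map (Int.castRingHom ℝ) := by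
    refine Finset.prod_dvd_of_coprime ((pairwise_coprime_X_sub_C hinj).set_pairwise _) fun i _ => ?_
    rw [dvd_iff_isRoot, map_quintic]
    fin_cases i <;> simpa
  refine (eq_of_monic_of_dvd_of_natDegree_le (monic_prod_X_sub_C _ _) (quintic_monic.map _) hdvd
    ?_).symm
  rw [quintic_monic.natDegree_map, quintic_natDegree, natDegree_finsetProd_X_sub_C_eq_card]
  simp

theorem IsRootList.exists_eq_of_eval_eq_zero {R : Type*} [CommRing R] [IsDomain R] {v : Fin 5 → R}
    (hv : IsRootList v) {x : R} (hx : x ^ 5 - 2 * x ^ 4 - 3 * x ^ 3 + 5 * x ^ 2 + x - 1 = 0) :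
    ∃ i, x = v i := by
  have h := congrArg (Polynomial.eval x) hv
  rw [map_quintic, Polynomial.eval_prod] at h
  simp [hx, Finset.prod_eq_zero_iff, sub_eq_zero] at h
  exact h

/-- All roots of the quintic in `ℂ` are real. -/
theorem IsRootList.conj_eq {v : Fin 5 → ℂ} (hv : IsRootList v) (i : Fin 5) :
    (starRingEnd ℂ) (v i) = v i := by
  obtain ⟨r, hr⟩ := exists_isRootList_real
  obtain ⟨j, hj⟩ := (hr.map Complex.ofRealHom).exists_eq_of_eval_eq_zero (hv.eval_eq i)
  rw [hj]
  simp

/-! ### The unramified extension generated by the roots -/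

theorem algHom_ext_of_adjoin_eq_top {F E A : Type*} [Field F] [Field E] [Algebra F E] [Field A]
    [Algebra F A] {S : Set E} (hS : IntermediateField.adjoin F S = ⊤) {φ ψ : E →ₐ[F] A}
    (h : ∀ x ∈ S, φ x = ψ x) : φ = ψ := by
  ext x
  have hx : x ∈ IntermediateField.adjoin F S := hS ▸ IntermediateField.mem_top
  induction hx using IntermediateField.adjoin_induction with
  | mem x hx => exact h x hx
  | algebraMap x => rw [φ.commutes, ψ.commutes]
  | add x y _ _ hx hy => rw [map_add, map_add, hx, hy]
  | inv x _ hx => rw [map_inv₀, map_inv₀, hx]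
  | mul x y _ _ hx hy => rw [map_mul, map_mul, hx, hy]

section Perm

variable {L : Type*} [Field L] [CharZero L] {v : Fin 5 → L}

theorem IsRootList.injective (hv : IsRootList v) : Function.Injective v := by
  intro i j h
  by_contra hij
  have := (hv.double_root hij h).1
  norm_num at this

theorem IsRootList.exists_perm (hv : IsRootList v) (σ : L →+* L) :
    ∃ π : Equiv.Perm (Fin 5), ∀ i, σ (v i) = v (π i) := by
  have h (i : Fin 5) : ∃ j, σ (v i) = v j :=
    hv.exists_eq_of_eval_eq_zero ((hv.map σ).eval_eq i)
  choose π hπ using h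
  have hinj : Function.Injective π := fun i j hij =>
    hv.injective (σ.injective (by rw [hπ, hπ, hij]))
  exact ⟨Equiv.ofBijective π (Finite.injective_iff_bijective.1 hinj), hπ⟩

/-- The action of the Galois group on the five roots. -/
def rootPerm (hv : IsRootList v) (k : Type*) [Field k] [Algebra k L] :
    Gal(L/k) →* Equiv.Perm (Fin 5) :=
  MonoidHom.mk' (fun σ => (hv.exists_perm (σ : L →+* L)).choose) fun σ τ => by
    ext1 i
    apply hv.injective
    rw [← (hv.exists_perm ((σ * τ : Gal(L/k)) : L →+* L)).choose_spec i, Equiv.Perm.mul_apply,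
      ← (hv.exists_perm (σ : L →+* L)).choose_spec, ← (hv.exists_perm (τ : L →+* L)).choose_spec]
    rfl

theorem apply_root (hv : IsRootList v) {k : Type*} [Field k] [Algebra k L] (σ : Gal(L/k))
    (i : Fin 5) : σ (v i) = v (rootPerm hv k σ i) :=
  (hv.exists_perm (σ : L →+* L)).choose_spec i

/-- The Galois group acts on the square root of the discriminant through the sign of the
permutation of the roots. -/
theorem map_det_vandermonde (hv : IsRootList v) {k : Type*} [Field k] [Algebra k L]
    (σ : Gal(L/k)) : σ (Matrix.vandermonde v).det =
      (Equiv.Perm.sign (rootPerm hv k σ) : ℤ) * (Matrix.vandermonde v).det := by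
  have h : σ (Matrix.vandermonde v).det =
      ((σ : L →+* L).mapMatrix (Matrix.vandermonde v)).det := RingHom.map_det (σ : L →+* L) _
  rw [h, ← Matrix.det_permute]
  congr 1
  ext i j
  simp [Matrix.vandermonde_apply, apply_root hv]

end Perm

section Galois

variable {K L : Type*} [Field K] [NumberField K] [Field L] [NumberField L] [Algebra K L]
  {v : Fin 5 → L}

/-- The roots of the quintic generate `L` over `ℚ`, as they generate a square root of `36497`. -/
theorem adjoin_rat_eq_top (hv : IsRootList v) (hL : IntermediateField.adjoin K (Set.range v) = ⊤)
    {δ : K} (hδ : δ ^ 2 = 36497) (hK : IntermediateField.adjoin ℚ {δ} = ⊤) :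
    IntermediateField.adjoin ℚ (Set.range v) = ⊤ := by
  set F := IntermediateField.adjoin ℚ (Set.range v) with hF
  have hvF (i : Fin 5) : v i ∈ F := IntermediateField.subset_adjoin _ _ ⟨i, rfl⟩
  have hD : (Matrix.vandermonde v).det ∈ F := by
    rw [Matrix.det_vandermonde]
    exact prod_mem fun i _ => prod_mem fun j _ => sub_mem (hvF j) (hvF i)
  have hδF : algebraMap K L δ ∈ F := by
    have h : algebraMap K L δ ^ 2 = (Matrix.vandermonde v).det ^ 2 := by
      rw [← map_pow, hδ, hv.det_vandermonde_sq, map_ofNat]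
    obtain h | h := sq_eq_sq_iff_eq_or_eq_neg.1 h
    · exact h ▸ hD
    · exact h ▸ neg_mem hD
  have hKF (x : K) : algebraMap K L x ∈ F := by
    have hx : x ∈ IntermediateField.adjoin ℚ {δ} := hK ▸ IntermediateField.mem_top
    have : IntermediateField.adjoin ℚ {δ} ≤ F.comap (IsScalarTower.toAlgHom ℚ K L) := by
      rw [IntermediateField.adjoin_le_iff, Set.singleton_subset_iff]
      exact hδF
    exact this hx
  rw [eq_top_iff]
  intro x _
  have hx : x ∈ IntermediateField.adjoin K (Set.range v) := hL ▸ IntermediateField.mem_top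
  induction hx using IntermediateField.adjoin_induction with
  | mem x hx => exact IntermediateField.subset_adjoin _ _ hx
  | algebraMap x => exact hKF x
  | add x y _ _ hx hy => exact add_mem (hx trivial) (hy trivial)
  | inv x _ hx => exact inv_mem (hx trivial)
  | mul x y _ _ hx hy => exact mul_mem (hx trivial) (hy trivial)

theorem IsRootList.splits {F : Type*} [Field F] {w : Fin 5 → F} (hw : IsRootList w) :
    (quintic.map (Int.castRingHom F)).Splits := by
  rw [← hw]
  exact Polynomial.Splits.prod fun i _ => Polynomial.Splits.X_sub_C _

theorem aeval_quintic (x : L) : aeval x (quintic.map (Int.castRingHom ℚ)) =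
    x ^ 5 - 2 * x ^ 4 - 3 * x ^ 3 + 5 * x ^ 2 + x - 1 := by
  simp [aeval_def, quintic, Polynomial.map_ofNat, eval₂_ofNat]

theorem IsRootList.rootSet_eq (hv : IsRootList v) :
    (quintic.map (Int.castRingHom ℚ)).rootSet L = Set.range v := by
  ext x
  rw [(quintic_monic.map _).mem_rootSet, aeval_quintic]
  constructor
  · intro h
    obtain ⟨i, rfl⟩ := hv.exists_eq_of_eval_eq_zero h
    exact ⟨i, rfl⟩
  · rintro ⟨i, rfl⟩
    exact hv.eval_eq i

theorem isGalois_rat (hv : IsRootList v) (hQ : IntermediateField.adjoin ℚ (Set.range v) = ⊤) :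
    IsGalois ℚ L := by
  have : (quintic.map (Int.castRingHom ℚ)).IsSplittingField ℚ L := by
    rw [isSplittingField_iff_intermediateField, hv.rootSet_eq]
    refine ⟨?_, hQ⟩
    rw [Polynomial.map_map, RingHom.ext_int ((algebraMap ℚ L).comp (Int.castRingHom ℚ))
      (Int.castRingHom L)]
    exact hv.splits
  exact IsGalois.of_separable_splitting_field quintic_irreducible_rat.separable

theorem rootPerm_injective (hv : IsRootList v) {k : Type*} [Field k] [Algebra k L]
    (hk : IntermediateField.adjoin k (Set.range v) = ⊤) :
    Function.Injective (rootPerm hv k) := by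
  intro σ τ h
  have : (σ : L →ₐ[k] L) = τ := by
    refine algHom_ext_of_adjoin_eq_top hk ?_
    rintro _ ⟨i, rfl⟩
    change σ (v i) = τ (v i)
    rw [apply_root hv, apply_root hv, h]
  exact AlgEquiv.ext fun x => DFunLike.congr_fun this x

theorem five_dvd_card [IsGalois ℚ L] (hv : IsRootList v) : 5 ∣ Nat.card Gal(L/ℚ) := by
  rw [IsGalois.card_aut_eq_finrank]
  have h1 := minpoly.eq_of_irreducible_of_monic quintic_irreducible_rat (x := v 0)
    (by rw [aeval_quintic, hv.eval_eq])
    (quintic_monic.map _)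
  have h2 := minpoly.degree_dvd (K := ℚ) (x := v 0) (Algebra.IsIntegral.isIntegral _)
  rwa [← h1, quintic_monic.natDegree_map, quintic_natDegree] at h2

/-- An element of an inertia group permutes the roots trivially or by a transposition. -/
theorem rootPerm_of_mem_inertia (hv : IsRootList v) {k : Type*} [Field k] [Algebra k L]
    (P : Ideal (𝓞 L)) [P.IsPrime] {σ : Gal(L/k)} (hσ : σ ∈ P.inertia Gal(L/k)) :
    rootPerm hv k σ = 1 ∨ (rootPerm hv k σ).IsSwap := by
  have hint (i : Fin 5) : IsIntegral ℤ (v i) := by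
    refine ⟨quintic, quintic_monic, ?_⟩
    simpa [quintic] using hv.eval_eq i
  let w : Fin 5 → 𝓞 L := fun i => ⟨v i, hint i⟩
  have hw : IsRootList w := .of_map (algebraMap (𝓞 L) L) NumberField.RingOfIntegers.coe_injective hv
  refine (hw.map (Ideal.Quotient.mk P)).eq_one_or_isSwap _ fun i => ?_
  rw [Ideal.Quotient.eq]
  have h : σ • w i = w (rootPerm hv k σ i) := ?_
  · exact h ▸ hσ (w i)
  apply NumberField.RingOfIntegers.coe_injective
  exact apply_root hv σ i

theorem card_inertia_eq_ramificationIdx (k : Type*) [Field k] [NumberField k] [Algebra k L]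
    [IsGalois k L] (P : Ideal (𝓞 L)) [P.IsPrime] :
    Nat.card (P.inertia Gal(L/k)) = P.ramificationIdx (𝓞 k) := by
  have : IsGaloisGroup Gal(L/k) (𝓞 k) (𝓞 L) := .of_isFractionRing _ _ _ k L
  rw [Ideal.card_inertia_eq_ramificationIdxIn (R := 𝓞 k) (G := Gal(L/k)) (P.under (𝓞 k)) P,
    Ideal.ramificationIdxIn_eq_ramificationIdx _ P Gal(L/k)]

/-- Some inertia group over `ℚ` is nontrivial, by Minkowski's theorem, and its nontrivial elements
act on the roots as transpositions. -/
theorem exists_isSwap_rootPerm [IsGalois ℚ L] (hv : IsRootList v)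
    (hQ : IntermediateField.adjoin ℚ (Set.range v) = ⊤) :
    ∃ σ : Gal(L/ℚ), (rootPerm hv ℚ σ).IsSwap := by
  have hfin : Module.finrank ℚ L ≠ 1 := by
    intro h
    have := five_dvd_card hv
    rw [IsGalois.card_aut_eq_finrank, h] at this
    omega
  obtain ⟨P, hPm, hP⟩ := NumberField.exists_not_isUnramifiedAt_int (𝒪 := 𝓞 L) hfin
  have hgal : IsGaloisGroup Gal(L/ℚ) ℤ (𝓞 L) := .of_isFractionRing _ _ _ ℚ L
  have hcard : Nat.card (P.inertia Gal(L/ℚ)) ≠ 1 := by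
    rwa [Ideal.card_inertia_eq_ramificationIdxIn (R := ℤ) (G := Gal(L/ℚ)) (P.under ℤ) P,
      Ideal.ramificationIdxIn_eq_ramificationIdx _ P Gal(L/ℚ), Ne, Ideal.ramificationIdx_eq_one_iff]
  obtain ⟨⟨σ, hσ⟩, h1⟩ := Subgroup.ne_bot_iff_exists_ne_one.1
    (fun h => hcard (Subgroup.card_eq_one.2 h))
  refine ⟨σ, (rootPerm_of_mem_inertia hv P hσ).resolve_left fun h => h1 (Subtype.ext ?_)⟩
  exact rootPerm_injective hv hQ (h.trans (map_one _).symm)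

/-- The Galois group over `ℚ` is the full symmetric group: its order is divisible by the prime `5`
and it contains a transposition. -/
theorem rootPerm_surjective [IsGalois ℚ L] (hv : IsRootList v)
    (hQ : IntermediateField.adjoin ℚ (Set.range v) = ⊤) :
    Function.Surjective (rootPerm hv ℚ) := by
  classical
  obtain ⟨σ, hσ⟩ := exists_isSwap_rootPerm hv hQ
  rw [← MonoidHom.range_eq_top]
  refine Equiv.Perm.subgroup_eq_top_of_swap_mem (by rw [Fintype.card_fin]; norm_num) ?_ ⟨σ, rfl⟩ hσ
  rw [Fintype.card_fin, Fintype.card_eq_nat_card,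
    ← Nat.card_congr (MonoidHom.ofInjective (rootPerm_injective hv hQ)).toEquiv]
  exact five_dvd_card hv

/-- An automorphism of `L` over `ℚ` fixes `K = ℚ(√36497)` if and only if it permutes the roots
evenly. -/
theorem range_rootPerm [IsGalois ℚ L] (hv : IsRootList v)
    (hQ : IntermediateField.adjoin ℚ (Set.range v) = ⊤)
    {δ : K} (hδ : δ ^ 2 = 36497) (hK : IntermediateField.adjoin ℚ {δ} = ⊤) :
    (rootPerm hv K).range = alternatingGroup (Fin 5) := by
  have hD0 : (Matrix.vandermonde v).det ≠ 0 := by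
    intro h
    have := hv.det_vandermonde_sq
    rw [h] at this
    norm_num at this
  have hδD : (Matrix.vandermonde v).det = algebraMap K L δ ∨
      (Matrix.vandermonde v).det = - algebraMap K L δ := by
    rw [← sq_eq_sq_iff_eq_or_eq_neg, ← map_pow, hδ, hv.det_vandermonde_sq, map_ofNat]
  ext π
  rw [Equiv.Perm.mem_alternatingGroup]
  constructor
  · rintro ⟨σ, rfl⟩
    have h := map_det_vandermonde hv σ
    have h2 : σ (Matrix.vandermonde v).det = (Matrix.vandermonde v).det := by
      obtain h | h := hδD <;> rw [h] <;> simp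
    rw [h2] at h
    obtain h3 | h3 := Int.units_eq_one_or (Equiv.Perm.sign (rootPerm hv K σ))
    · exact h3
    · rw [h3] at h
      simp only [Units.val_neg, Units.val_one, Int.cast_neg, Int.cast_one, neg_mul, one_mul] at h
      exact absurd (self_eq_neg.1 h) hD0
  · intro hπ
    obtain ⟨σ, rfl⟩ := rootPerm_surjective hv hQ π
    have h := map_det_vandermonde hv σ
    rw [hπ, Units.val_one, Int.cast_one, one_mul] at h
    have hσδ : σ (algebraMap K L δ) = algebraMap K L δ := by
      obtain h3 | h3 := hδD <;> rw [h3] at h <;> simpa using h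
    have hσK : ∀ x : K, σ (algebraMap K L x) = algebraMap K L x := by
      have : ((σ : L →ₐ[ℚ] L).comp (IsScalarTower.toAlgHom ℚ K L)) = IsScalarTower.toAlgHom ℚ K L :=
        algHom_ext_of_adjoin_eq_top hK (by rintro _ rfl; exact hσδ)
      exact fun x => DFunLike.congr_fun this x
    refine ⟨AlgEquiv.ofRingEquiv (f := σ.toRingEquiv) hσK, ?_⟩
    ext1 i
    apply hv.injective
    rw [← apply_root hv, ← apply_root hv]
    rfl

theorem isTotallyReal_of_isRootList (hv : IsRootList v)
    (hQ : IntermediateField.adjoin ℚ (Set.range v) = ⊤) : NumberField.IsTotallyReal L where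
  isReal w := by
    rw [NumberField.InfinitePlace.isReal_iff, NumberField.ComplexEmbedding.isReal_iff]
    have : (NumberField.ComplexEmbedding.conjugate w.embedding).toRatAlgHom =
        w.embedding.toRatAlgHom := by
      refine algHom_ext_of_adjoin_eq_top hQ ?_
      rintro _ ⟨i, rfl⟩
      exact (hv.map w.embedding).conj_eq i
    exact RingHom.ext fun x => DFunLike.congr_fun this x

/-- If `K = ℚ(√36497)` and `L` is generated over `K` by the roots of the quintic, then `L / K` is
an unramified extension with group `A₅`: an inertia group over `K` acts on the roots through
`{1, transposition}`, and evenly. -/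
theorem isUnramifiedTotallyRealA5_of_isRootList (hv : IsRootList v)
    (hL : IntermediateField.adjoin K (Set.range v) = ⊤)
    {δ : K} (hδ : δ ^ 2 = 36497) (hK : IntermediateField.adjoin ℚ {δ} = ⊤) :
    IsUnramifiedTotallyRealA5 K L := by
  have hQ := adjoin_rat_eq_top hv hL hδ hK
  have : IsGalois ℚ L := isGalois_rat hv hQ
  have hgal : IsGalois K L := IsGalois.tower_top_of_isGalois ℚ K L
  have hreal := isTotallyReal_of_isRootList hv hQ
  have hinj := rootPerm_injective hv hL
  have hrange := range_rootPerm hv hQ hδ hK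
  refine ⟨inferInstance, hgal, ⟨?_⟩, ⟨fun P hP _ => ?_, ?_⟩, hreal⟩
  · exact (MonoidHom.ofInjective hinj).trans (MulEquiv.subgroupCongr hrange)
  · rw [← card_inertia_eq_ramificationIdx K P, Subgroup.card_eq_one, eq_bot_iff]
    intro σ hσ
    have heven : rootPerm hv K σ ∈ alternatingGroup (Fin 5) := hrange ▸ ⟨σ, rfl⟩
    obtain h | h := rootPerm_of_mem_inertia hv P hσ
    · exact hinj (h.trans (map_one _).symm)
    · rw [Equiv.Perm.mem_alternatingGroup, h.sign_eq] at heven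
      exact absurd heven (by decide)
  · exact ⟨fun w => NumberField.InfinitePlace.IsReal.isUnramified K (hreal.isReal w)⟩

end Galois

/-! ### The class number of `ℚ(√36497)` -/

/-- `quadField` is defined by adjoining both square roots of `36497`; one of them suffices. -/
theorem exists_sqrt : ∃ δ : quadField, δ ^ 2 = 36497 ∧ IntermediateField.adjoin ℚ {δ} = ⊤ := by
  obtain ⟨d, hd⟩ := IsAlgClosed.exists_pow_nat_eq (36497 : Qbar) two_pos
  have hmem : d ∈ quadField := IntermediateField.subset_adjoin _ _ hd
  refine ⟨⟨d, hmem⟩, Subtype.ext hd, eq_top_iff.2 fun ⟨x, hx⟩ _ => ?_⟩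
  have hd' := IntermediateField.mem_adjoin_simple_self ℚ (⟨d, hmem⟩ : quadField)
  induction hx using IntermediateField.adjoin_induction with
  | mem x hx =>
    have h : x ^ 2 = d ^ 2 := hx.trans hd.symm
    obtain rfl | rfl := sq_eq_sq_iff_eq_or_eq_neg.1 h
    · exact hd'
    · exact neg_mem hd'
  | algebraMap q =>
    convert (IntermediateField.adjoin ℚ {(⟨d, hmem⟩ : quadField)}).algebraMap_mem q
    exact Subtype.ext (by simp)
  | add x y _ _ hx hy => exact add_mem (hx trivial) (hy trivial)
  | inv x _ hx => exact inv_mem (hx trivial)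
  | mul x y _ _ hx hy => exact mul_mem (hx trivial) (hy trivial)

section Quadratic

variable {K : Type*} [Field K] [NumberField K] {δ : K}

theorem no_rat_sqrt (r : ℚ) : r ^ 2 ≠ 36497 := by
  intro h
  have hsq : IsSquare (36497 : ℚ) := ⟨r, by rw [← h, sq]⟩
  have : IsSquare (36497 : ℕ) := by exact_mod_cast hsq
  exact absurd this (by decide +kernel)

theorem minpoly_sqrt (hδ : δ ^ 2 = 36497) : minpoly ℚ δ = X ^ 2 - C 36497 := by
  symm
  apply minpoly.eq_of_irreducible_of_monic
  · rw [X_pow_sub_C_irreducible_iff_of_prime Nat.prime_two]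
    exact no_rat_sqrt
  · simp [hδ]
  · exact monic_X_pow_sub_C _ two_ne_zero

theorem finrank_quadratic (hδ : δ ^ 2 = 36497) (hK : IntermediateField.adjoin ℚ {δ} = ⊤) :
    Module.finrank ℚ K = 2 := by
  rw [← IntermediateField.finrank_top', ← hK,
    IntermediateField.adjoin.finrank (Algebra.IsIntegral.isIntegral δ), minpoly_sqrt hδ,
    natDegree_X_pow_sub_C]

theorem isTotallyReal_quadratic (hδ : δ ^ 2 = 36497) (hK : IntermediateField.adjoin ℚ {δ} = ⊤) :
    NumberField.IsTotallyReal K where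
  isReal w := by
    rw [NumberField.InfinitePlace.isReal_iff, NumberField.ComplexEmbedding.isReal_iff]
    have : (NumberField.ComplexEmbedding.conjugate w.embedding).toRatAlgHom =
        w.embedding.toRatAlgHom := by
      refine algHom_ext_of_adjoin_eq_top hK ?_
      intro x hx
      rw [Set.mem_singleton_iff.1 hx]
      change (starRingEnd ℂ) (w.embedding δ) = w.embedding δ
      have h : w.embedding δ ^ 2 = ((Real.sqrt 36497 : ℝ) : ℂ) ^ 2 := by
        rw [← map_pow, hδ, ← Complex.ofReal_pow, Real.sq_sqrt (by norm_num), map_ofNat]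
        simp
      obtain h | h := sq_eq_sq_iff_eq_or_eq_neg.1 h <;> rw [h] <;> simp
    exact RingHom.ext fun x => DFunLike.congr_fun this x

/-- The integer `ω = (1 + √36497) / 2`, a root of `x² - x - 9124`, and the basis `1, ω` of `K`. -/
theorem exists_omega (hδ : δ ^ 2 = 36497) (hK : IntermediateField.adjoin ℚ {δ} = ⊤) :
    ∃ (ω : 𝓞 K) (b : Module.Basis (Fin 2) ℚ K), ω ^ 2 = ω + 9124 ∧ b 0 = 1 ∧ b 1 = ω := by
  have h0 : ((1 + δ) / 2) ^ 2 = (1 + δ) / 2 + 9124 := by linear_combination hδ / 4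
  have hint : IsIntegral ℤ ((1 + δ) / 2) := by
    refine ⟨X ^ 2 - X - 9124, by monicity!, ?_⟩
    simp [h0]
  have hli : LinearIndependent ℚ ![1, (1 + δ) / 2] := by
    rw [LinearIndependent.pair_iff]
    intro s t hst
    rw [Algebra.smul_def, Algebra.smul_def] at hst
    simp only [eq_ratCast, mul_one] at hst
    have ht : t = 0 := by
      by_contra ht
      have ht' : (t : K) ≠ 0 := by exact_mod_cast ht
      have hδr : δ = ((-2 * s / t - 1 : ℚ) : K) := by
        push_cast
        field_simp
        linear_combination 2 * hst
      refine no_rat_sqrt (-2 * s / t - 1) ?_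
      rw [hδr] at hδ
      exact_mod_cast hδ
    rw [ht] at hst
    refine ⟨?_, ht⟩
    simpa using hst
  let b := basisOfLinearIndependentOfCardEqFinrank hli
    (by rw [Fintype.card_fin, finrank_quadratic hδ hK])
  obtain ⟨ω, hω⟩ : ∃ ω : 𝓞 K, (ω : K) = (1 + δ) / 2 := ⟨⟨_, hint⟩, rfl⟩
  refine ⟨ω, b, NumberField.RingOfIntegers.coe_injective ?_, by simp [b], by simp [b, hω]⟩
  rw [map_pow, map_add, map_ofNat]
  change (ω : K) ^ 2 = ω + 9124
  rw [hω]
  exact h0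

variable {ω : 𝓞 K} {b : Module.Basis (Fin 2) ℚ K}

theorem leftMulMatrix_quadratic (hω : ω ^ 2 = ω + 9124) (b0 : b 0 = 1) (b1 : b 1 = ω) (x y : ℤ) :
    Algebra.leftMulMatrix b ((x + y * ω : 𝓞 K) : K) = !![(x : ℚ), 9124 * y; (y : ℚ), x + y] := by
  have hω' : (ω : K) ^ 2 = ω + 9124 := by
    have := congrArg (algebraMap (𝓞 K) K) hω
    rwa [map_pow, map_add, map_ofNat] at this
  have e0 : ((x + y * ω : 𝓞 K) : K) * b 0 = (x : ℚ) • b 0 + (y : ℚ) • b 1 := by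
    simp [b0, b1, Algebra.smul_def]
  have e1 : ((x + y * ω : 𝓞 K) : K) * b 1 = (9124 * y : ℚ) • b 0 + (x + y : ℚ) • b 1 := by
    simp [b0, b1, Algebra.smul_def]
    linear_combination (y : K) * hω'
  ext i j
  rw [Algebra.leftMulMatrix_eq_repr_mul]
  fin_cases j
  · simp only [Fin.zero_eta]
    rw [e0]
    fin_cases i <;> simp
  · simp only [Fin.mk_one]
    rw [e1]
    fin_cases i <;> simp

theorem norm_quadratic (hω : ω ^ 2 = ω + 9124) (b0 : b 0 = 1) (b1 : b 1 = ω) (x y : ℤ) :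
    Algebra.norm ℤ (x + y * ω : 𝓞 K) = x ^ 2 + x * y - 9124 * y ^ 2 := by
  have h : ((Algebra.norm ℤ (x + y * ω : 𝓞 K) : ℤ) : ℚ) = x ^ 2 + x * y - 9124 * y ^ 2 := by
    rw [Algebra.coe_norm_int, Algebra.norm_eq_matrix_det b, leftMulMatrix_quadratic hω b0 b1,
      Matrix.det_fin_two_of]
    ring
  exact_mod_cast h

theorem trace_quadratic (hω : ω ^ 2 = ω + 9124) (b0 : b 0 = 1) (b1 : b 1 = ω) (x y : ℤ) :
    Algebra.trace ℤ (𝓞 K) (x + y * ω : 𝓞 K) = 2 * x + y := by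
  have h : ((Algebra.trace ℤ (𝓞 K) (x + y * ω : 𝓞 K) : ℤ) : ℚ) = 2 * x + y := by
    rw [Algebra.coe_trace_int, Algebra.trace_eq_matrix_trace b, leftMulMatrix_quadratic hω b0 b1,
      Matrix.trace_fin_two_of]
    ring
  exact_mod_cast h

/-- The discriminant of `K` divides that of the order `ℤ[ω]`. -/
theorem abs_discr_le (hω : ω ^ 2 = ω + 9124) (b0 : b 0 = 1) (b1 : b 1 = ω) :
    |NumberField.discr K| ≤ 36497 := by
  have hd : Algebra.discr ℤ ![1, ω] = 36497 := by
    have t := trace_quadratic hω b0 b1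
    have t1 : Algebra.trace ℤ (𝓞 K) 1 = 2 := by simpa using t 1 0
    have t2 : Algebra.trace ℤ (𝓞 K) ω = 1 := by simpa using t 0 1
    have t3 : Algebra.trace ℤ (𝓞 K) (ω * ω) = 18249 := by
      have := t 9124 1
      rw [← sq, hω, add_comm]
      simpa using this
    rw [Algebra.discr_def, Matrix.det_fin_two]
    simp [Algebra.traceMatrix_apply, Algebra.traceForm_apply, t1, t2, t3]
  have hcard : Fintype.card (Module.Free.ChooseBasisIndex ℤ (𝓞 K)) = Fintype.card (Fin 2) := by
    rw [← Module.finrank_eq_card_chooseBasisIndex, NumberField.RingOfIntegers.rank,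
      Module.finrank_eq_card_basis b]
  let c := (NumberField.RingOfIntegers.basis K).reindex (Fintype.equivOfCardEq hcard)
  have h := c.toMatrix_map_vecMul ![1, ω]
  have h2 := Algebra.discr_of_matrix_vecMul (c : Fin 2 → 𝓞 K) (c.toMatrix ![1, ω])
  rw [h, hd, NumberField.discr_eq_discr K c] at h2
  refine Int.le_of_dvd (by norm_num) ?_
  rw [abs_dvd, h2]
  exact dvd_mul_left _ _

theorem eq_of_le_of_absNorm_eq {I P : Ideal (𝓞 K)} (h : I ≤ P) (hI : Ideal.absNorm I ≠ 0)
    (hn : Ideal.absNorm I = Ideal.absNorm P) : I = P := by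
  obtain ⟨J, rfl⟩ := Ideal.dvd_iff_le.2 h
  rw [map_mul] at hn hI
  have : Ideal.absNorm J = 1 := by
    apply Nat.eq_of_mul_eq_mul_left (Nat.pos_of_ne_zero (left_ne_zero_of_mul hI))
    rw [hn, mul_one]
  rw [Ideal.absNorm_eq_one_iff.1 this, Ideal.mul_top]

/-- Pairs `(x, y)` such that `x + y ω` generates a prime ideal of degree one and norm at most
`95`; each such ideal is generated by one of them. As `|x² + xy - 9124y²| < √36497 / 2`, each
`|x / y|` is a convergent of the continued fraction of `ω` or of minus the conjugate of `ω`. -/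
def generators : List (ℤ × ℤ) :=
  [(5806349083977532334, 61105994921702217), (5867455078899234551, -61105994921702217),
    (163580577291, 1721521352), (165302098643, -1721521352),
    (84561182403457, 889921551010), (85451103954467, -889921551010),
    (9751619, 102626), (9854245, -102626),
    (4609, -48), (4561, 48),
    (8501966545, -88542838), (8413423707, 88542838),
    (222349, 2340), (224689, -2340),
    (3705021944027, 38991636366), (3744013580393, -38991636366),
    (45912853442555833, 483186689040712), (46396040131596545, -483186689040712),
    (1579077419, -16445136), (1562632283, 16445136)]

set_option synthInstance.maxSize 1000 in
set_option synthInstance.maxHeartbeats 200000 in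
/-- Every root `a` modulo `p < 96` of the minimal polynomial of `ω`, that is, every prime ideal
`(p, ω - a)`, has a generator in the table. -/
theorem exists_generator : ∀ p : ℕ, p < 96 → 2 ≤ p → (∀ d < p, 2 ≤ d → ¬ d ∣ p) →
    ∀ a < p, (p : ℤ) ∣ (a : ℤ) ^ 2 - a - 9124 → ∃ g ∈ generators, (p : ℤ) ∣ g.1 + g.2 * a ∧
      (g.1 ^ 2 + g.1 * g.2 - 9124 * g.2 ^ 2).natAbs = p := by
  decide +kernel

/-- A prime ideal of norm `p` is `(p, ω - a)` for a root `a` of `x² - x - 9124` modulo `p`, so the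
table has a generator; a prime ideal of norm `p²` is generated by `p`. -/
theorem isPrincipal_of_absNorm_lt (hω : ω ^ 2 = ω + 9124) (b0 : b 0 = 1) (b1 : b 1 = ω)
    (P : Ideal (𝓞 K)) [hP : P.IsPrime] (hP0 : P ≠ ⊥) (hn : Ideal.absNorm P < 96) :
    P.IsPrincipal := by
  have : P.IsMaximal := hP.isMaximal hP0
  obtain ⟨p, k, -, hpP, hp, hk⟩ := Ideal.exists_prime_and_absNorm_eq_pow P
  have hle : Ideal.span {(p : 𝓞 K)} ≤ P := (Ideal.span_singleton_le_iff_mem _).2 hpP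
  have hpn : Ideal.absNorm (Ideal.span {(p : 𝓞 K)}) = p ^ 2 := by
    rw [Ideal.absNorm_span_singleton]
    have := norm_quadratic hω b0 b1 p 0
    simp at this
    rw [this]; simp
  have hk2 : k ≤ 2 := by
    rw [← Nat.pow_dvd_pow_iff_le_right hp.one_lt, ← hk, ← hpn]
    exact Ideal.absNorm_dvd_absNorm_of_le hle
  interval_cases k
  · exact absurd (Ideal.absNorm_eq_one_iff.1 (hk.trans (pow_zero p))) hP.ne_top
  · rw [pow_one] at hk
    have : Fact p.Prime := ⟨hp⟩
    have : CharP (𝓞 K ⧸ P) p := by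
      have h0 : (p : 𝓞 K ⧸ P) = 0 := by
        rw [← map_natCast (Ideal.Quotient.mk P)]
        exact Ideal.Quotient.eq_zero_iff_mem.2 hpP
      have := CharP.ringChar_of_prime_eq_zero hp h0
      exact ringChar.of_eq this
    have hbij : Function.Bijective (ZMod.castHom dvd_rfl (𝓞 K ⧸ P) : ZMod p →+* 𝓞 K ⧸ P) := by
      have : Finite (𝓞 K ⧸ P) := (Ideal.absNorm_ne_zero_iff P).1 (hk ▸ hp.ne_zero)
      refine (Nat.bijective_iff_injective_and_card _).2 ⟨RingHom.injective _, ?_⟩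
      rw [Nat.card_zmod, ← hk]
      rfl
    obtain ⟨a, ha⟩ := hbij.2 (Ideal.Quotient.mk P ω)
    have ha' : (Ideal.Quotient.mk P ω) = ((a.val : ℕ) : 𝓞 K ⧸ P) := by
      rw [← ha, ZMod.castHom_apply, ZMod.natCast_val]
    have hroot : (p : ℤ) ∣ (a.val : ℤ) ^ 2 - a.val - 9124 := by
      rw [← CharP.intCast_eq_zero_iff (𝓞 K ⧸ P)]
      push_cast
      rw [← ha', ← map_pow, hω, map_add, map_ofNat]
      ring
    obtain ⟨⟨x, y⟩, -, hxy, hnorm⟩ := exists_generator p (hk ▸ hn) hp.two_le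
      (fun d hd h2 hdp => by
        obtain h | h := (Nat.dvd_prime hp).1 hdp <;> omega) a.val (ZMod.val_lt a) hroot
    have hmem : (x + y * ω : 𝓞 K) ∈ P := by
      rw [← Ideal.Quotient.eq_zero_iff_mem, map_add, map_mul, ha']
      rw [← CharP.intCast_eq_zero_iff (𝓞 K ⧸ P)] at hxy
      simpa using hxy
    have hgen : Ideal.absNorm (Ideal.span {(x + y * ω : 𝓞 K)}) = p := by
      rw [Ideal.absNorm_span_singleton, norm_quadratic hω b0 b1, hnorm]
    exact ⟨_, (eq_of_le_of_absNorm_eq ((Ideal.span_singleton_le_iff_mem _).2 hmem)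
      (hgen ▸ hp.ne_zero) (hgen.trans hk.symm)).symm⟩
  · exact ⟨_, (eq_of_le_of_absNorm_eq hle (by rw [hpn]; exact pow_ne_zero _ hp.ne_zero)
      (hpn.trans hk.symm)).symm⟩

end Quadratic

/-- The Minkowski bound of `K` is `√36497 / 2 < 96`, and the prime ideals of smaller norm are
principal. -/
theorem classNumber_quadField : NumberField.classNumber quadField = 1 := by
  obtain ⟨δ, hδ, hK⟩ := exists_sqrt
  obtain ⟨ω, b, hω, b0, b1⟩ := exists_omega hδ hK
  have := isTotallyReal_quadratic hδ hK
  rw [NumberField.classNumber_eq_one_iff]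
  refine RingOfIntegers.isPrincipalIdealRing_of_isPrincipal_of_norm_le_of_isPrime
    fun ⟨P, hP0⟩ hP hn => ?_
  have : P.IsPrime := hP
  refine isPrincipal_of_absNorm_lt hω b0 b1 P (nonZeroDivisors.ne_zero hP0) ?_
  rw [NumberField.IsTotallyReal.nrComplexPlaces_eq_zero, finrank_quadratic hδ hK, pow_zero, one_mul,
    ← Int.cast_abs] at hn
  have hsq : Real.sqrt ((|NumberField.discr quadField| : ℤ) : ℝ) < 192 := by
    rw [Real.sqrt_lt' (by norm_num)]
    have : ((|NumberField.discr quadField| : ℤ) : ℝ) ≤ (36497 : ℤ) :=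
      Int.cast_le.2 (abs_discr_le hω b0 b1)
    norm_num at this ⊢
    linarith
  have h2 : ((Ideal.absNorm P : ℕ) : ℝ) < 96 := by
    refine hn.trans_lt ?_
    push_cast at hsq
    norm_num [Nat.factorial]
    linarith
  exact_mod_cast h2

end Arithmetic

/-! ### The inverse of the embedding matrix -/

section Different

variable {k L : Type*} [Field k] [NumberField k] [Field L] [NumberField L] [Algebra k L]

theorem differentIdeal_eq_top (h : IsEverywhereUnramified k L) :
    differentIdeal (𝓞 k) (𝓞 L) = ⊤ := by
  by_contra hne
  obtain ⟨P, hP, hle⟩ := Ideal.exists_le_maximal _ hne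
  have hP0 : P ≠ ⊥ := fun h0 => differentIdeal_ne_bot (le_bot_iff.1 (h0 ▸ hle))
  refine not_dvd_differentIdeal_iff (A := 𝓞 k).2 ?_ (Ideal.dvd_iff_le.2 hle)
  exact Ideal.ramificationIdx_eq_one_iff.1 (h.finite_places P hP.isPrime hP0)

/-- In an unramified extension the integers form a self-dual lattice for the trace form. -/
theorem isIntegral_of_forall_trace (h : IsEverywhereUnramified k L) {x : L}
    (hx : ∀ y : 𝓞 L, ∃ z : 𝓞 k, Algebra.trace k L (x * y) = z) : ∃ y : 𝓞 L, (y : L) = x := by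
  have h1 := coeSubmodule_differentIdeal (𝓞 k) k (L := L) (B := 𝓞 L)
  rw [differentIdeal_eq_top h, IsLocalization.coeSubmodule_top] at h1
  have hx' : x ∈ Submodule.traceDual (𝓞 k) k (1 : Submodule (𝓞 L) L) := by
    rw [Submodule.mem_traceDual]
    intro a ha
    obtain ⟨y, rfl⟩ := Submodule.mem_one.1 ha
    obtain ⟨z, hz⟩ := hx y
    exact ⟨z, hz.symm⟩
  have h2 : (1 : L) ∈ 1 / Submodule.traceDual (𝓞 k) k (1 : Submodule (𝓞 L) L) :=
    h1 ▸ Submodule.mem_one.2 ⟨1, map_one _⟩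
  have := Submodule.mem_div_iff_forall_mul_mem.1 h2 x hx'
  rw [one_mul] at this
  exact Submodule.mem_one.1 this

end Different

section Dual

variable {K : IntermediateField ℚ Qbar} [NumberField K] {L : IntermediateField K Qbar}
  [NumberField L] {n : ℕ}

/-- The trace-dual of an integral basis is integral, because the different is trivial. -/
theorem exists_dualBasis_integral (h : IsEverywhereUnramified K L)
    (u : Module.Basis (Fin n) (𝓞 K) (𝓞 L)) :
    ∃ y : Fin n → 𝓞 L, ∀ i j, Algebra.trace K L (y i * u j) = if i = j then 1 else 0 := by
  have htr (i j) := (integralBasisToField u).trace_traceDual_mul i j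
  have hex (i : Fin n) : ∃ y : 𝓞 L, (y : L) = (integralBasisToField u).traceDual i := by
    refine isIntegral_of_forall_trace h fun y => ⟨u.repr y i, ?_⟩
    have := (integralBasisToField u).traceDual.traceDual_repr_apply (y : L) i
    rw [Module.Basis.traceDual_traceDual, Algebra.traceForm_apply] at this
    rw [mul_comm, ← this]
    have : IsLocalization (Algebra.algebraMapSubmonoid (𝓞 L) (nonZeroDivisors (𝓞 K))) L :=
      isLocalization_integers
    exact u.localizationLocalization_repr_algebraMap K _ L y i
  choose y hy using hex
  refine ⟨y, fun i j => ?_⟩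
  rw [hy, ← integralBasisToField_apply, htr i j]
  exact if_congr eq_comm rfl rfl

/-- The inverse of the embedding matrix of an integral basis has entries `τ_j (y_i)`, where `y` is
the dual basis. -/
theorem exists_inv_embeddingGL (h : IsEverywhereUnramified K L)
    (u : Module.Basis (Fin n) (𝓞 K) (𝓞 L)) (τ : Fin n ≃ (L →ₐ[K] Qbar)) :
    ∃ y : Fin n → 𝓞 L,
      ((embeddingGL (integralBasisToField u) τ)⁻¹ : GL (Fin n) Qbar).val =
        Matrix.of fun i j => τ j (y i) := by
  obtain ⟨y, hy⟩ := exists_dualBasis_integral h u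
  refine ⟨y, ?_⟩
  have hmul : (Matrix.of fun i j => τ j (y i)) * (embeddingGL (integralBasisToField u) τ).val =
      1 := by
    ext i j
    have hsum := trace_eq_sum_embeddings (K := K) (L := L) Qbar (x := y i * u j)
    rw [hy, ← τ.sum_comp] at hsum
    simp only [map_mul] at hsum
    have hentry (k) : (embeddingGL (integralBasisToField u) τ).val k j = τ k (u j) := by
      rw [← integralBasisToField_apply]
      rfl
    simp only [Matrix.mul_apply, Matrix.of_apply, Matrix.one_apply, hentry]
    rw [← hsum]
    split_ifs <;> simp
  rw [Matrix.coe_units_inv]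
  exact Matrix.inv_eq_left_inv hmul

end Dual

/-! ### The group `U⁻¹ P U` and the Galois action -/

section General

variable {n p : ℕ}

/-- An invertible matrix is defined over a subring as soon as its entries and those of its inverse
lie there. -/
theorem mem_range_map_of_entries {R : Type*} [CommRing R] {φ : R →+* Qbar}
    (hφ : Function.Injective φ) {g : GL (Fin n) Qbar} (hg : ∀ i j, g.val i j ∈ φ.range)
    (hg' : ∀ i j, (g⁻¹).val i j ∈ φ.range) :
    g ∈ (Matrix.GeneralLinearGroup.map (n := Fin n) φ).range := by
  choose A hA using hg
  choose B hB using hg'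
  have hA' : (Matrix.of A).map φ = g.val := Matrix.ext hA
  have hB' : (Matrix.of B).map φ = (g⁻¹).val := Matrix.ext hB
  have hinj : Function.Injective fun M : Matrix (Fin n) (Fin n) R => M.map φ :=
    Matrix.map_injective hφ
  refine ⟨⟨Matrix.of A, Matrix.of B, hinj ?_, hinj ?_⟩, Units.ext hA'⟩
  · simp only [Matrix.map_mul, hA', hB']
    rw [← Units.val_mul, mul_inv_cancel]
    simp
  · simp only [Matrix.map_mul, hA', hB']
    rw [← Units.val_mul, inv_mul_cancel]
    simp

theorem map_eq_self_of_mem_glField {k : Type*} [Field k] [Algebra k Qbar]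
    {F : IntermediateField k Qbar} {g : GL (Fin n) Qbar} (hg : g ∈ glField n F)
    {σ : Gal(Qbar/k)} (hσ : ∀ x ∈ F, σ x = x) :
    Matrix.GeneralLinearGroup.map (σ : Qbar →+* Qbar) g = g := by
  obtain ⟨A, rfl⟩ := hg
  ext i j
  exact hσ _ (A.val i j).2

/-- A Galois extension `N` over which `G` is defined is the field of definition as soon as every
automorphism fixing `G` entrywise fixes `N`. -/
theorem isFieldOfDefinition_of_forall {k : Type*} [Field k] [Algebra k Qbar] [IsGalois k Qbar]
    {G : Subgroup (GL (Fin n) Qbar)} {N : IntermediateField k Qbar} (hN : IsGalois k N)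
    (hG : G ≤ glField n N)
    (h : ∀ σ : Gal(Qbar/k),
      (∀ g ∈ G, Matrix.GeneralLinearGroup.map (σ : Qbar →+* Qbar) g = g) → ∀ x ∈ N, σ x = x) :
    IsFieldOfDefinition k G N := by
  refine ⟨⟨hN, hG⟩, fun F hF => ?_⟩
  rw [← InfiniteGalois.fixedField_fixingSubgroup F]
  intro x hx
  rintro ⟨σ, hσ⟩
  refine h σ (fun g hg => map_eq_self_of_mem_glField (hF.2 hg) fun x hx => ?_) x hx
  exact (IntermediateField.mem_fixingSubgroup_iff F σ).1 hσ x hx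

theorem isGaloisStable_of_forall_mem {k : Type*} [Field k] [Algebra k Qbar]
    {G : Subgroup (GL (Fin n) Qbar)}
    (h : ∀ σ : Gal(Qbar/k), ∀ g ∈ G, Matrix.GeneralLinearGroup.map (σ : Qbar →+* Qbar) g ∈ G) :
    IsGaloisStable k G := by
  intro σ
  refine le_antisymm (Subgroup.map_le_iff_le_comap.2 fun g hg => h σ g hg) fun g hg => ?_
  refine ⟨_, h σ.symm g hg, ?_⟩
  ext i j
  exact σ.apply_symm_apply _

/-- `g` lies in `U⁻¹ P U` if and only if the rows of `U` are left eigenvectors of `g` whose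
eigenvalues `w i` are `p`-th roots of unity. -/
theorem mem_conjDiagTorsion (hp : p ≠ 0) {U g : GL (Fin n) Qbar} :
    g ∈ conjDiagTorsion p U ↔ ∃ w : Fin n → Qbar, (∀ i, w i ^ p = 1) ∧
      U.val * g.val = Matrix.diagonal w * U.val := by
  constructor
  · rintro ⟨_, ⟨d, hd, rfl⟩, rfl⟩
    refine ⟨d.val, fun i => ?_, ?_⟩
    · have : d ^ p = 1 := hd
      exact congrFun (congrArg Units.val this) i
    · simp [← mul_assoc]
  · rintro ⟨w, hw, h⟩
    have hw' : w ^ p = 1 := funext hw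
    refine ⟨_, ⟨Units.ofPowEqOne w p hw' hp, Units.pow_ofPowEqOne _ hp, rfl⟩, ?_⟩
    have : U * g = Units.map (Matrix.diagonalRingHom (Fin n) Qbar :
        (Fin n → Qbar) →* Matrix (Fin n) (Fin n) Qbar) (Units.ofPowEqOne w p hw' hp) * U :=
      Units.ext h
    change U⁻¹ * _ * U⁻¹⁻¹ = g
    rw [inv_inv, mul_assoc, ← this, inv_mul_cancel_left]

theorem finite_conjDiagTorsion (hp : p ≠ 0) (U : GL (Fin n) Qbar) :
    (conjDiagTorsion p U : Set (GL (Fin n) Qbar)).Finite := by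
  have h1 : {x : Qbar | x ^ p = 1}.Finite := by
    classical
    refine (Polynomial.nthRoots p (1 : Qbar)).toFinset.finite_toSet.subset fun x hx => ?_
    simpa [Polynomial.mem_nthRoots hp.bot_lt] using hx
  have h2 := Set.Finite.pi (fun _ : Fin n => h1)
  refine Set.Finite.of_finite_image (f := fun g => U.val * g.val)
    ((h2.image fun w => Matrix.diagonal w * U.val).subset ?_) fun g _ g' _ h => ?_
  · rintro _ ⟨g, hg, rfl⟩
    obtain ⟨w, hw, h⟩ := (mem_conjDiagTorsion hp).1 hg
    exact ⟨w, fun i _ => hw i, h.symm⟩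
  · exact mul_left_cancel (Units.ext h : U * g = U * g')

end General

section Action

variable {n p : ℕ} {k : Type*} [Field k] [Algebra k Qbar]
  {L : IntermediateField k Qbar} (τ : Fin n ≃ (L →ₐ[k] Qbar))

/-- The permutation of the embeddings of `L`, listed by `τ`, induced by an automorphism. -/
def embeddingPerm (σ : Gal(Qbar/k)) : Equiv.Perm (Fin n) :=
  (τ.trans (AlgEquiv.arrowCongr AlgEquiv.refl σ)).trans τ.symm

theorem embeddingPerm_apply (σ : Gal(Qbar/k)) (i : Fin n) (x : L) :
    τ (embeddingPerm τ σ i) x = σ (τ i x) := by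
  simp [embeddingPerm, AlgEquiv.arrowCongr]

variable [CharZero k] {u : Module.Basis (Fin n) k L} {τ}

/-- An automorphism permutes the rows of `U`, so it carries an element of `U⁻¹ P U` to another one,
with conjugated and permuted eigenvalues. -/
theorem map_mul_eq_diagonal_mul (σ : Gal(Qbar/k)) {g : GL (Fin n) Qbar} {w : Fin n → Qbar}
    (h : (embeddingGL u τ).val * g.val = Matrix.diagonal w * (embeddingGL u τ).val) :
    (embeddingGL u τ).val * (Matrix.GeneralLinearGroup.map (σ : Qbar →+* Qbar) g).val =
      Matrix.diagonal (fun i => σ (w ((embeddingPerm τ σ).symm i))) * (embeddingGL u τ).val := by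
  have hU (i j) : (embeddingGL u τ).val i j = τ i (u j) := rfl
  ext i j
  obtain ⟨i, rfl⟩ := (embeddingPerm τ σ).surjective i
  have := congrArg σ (congrFun (congrFun h i) j)
  rw [Matrix.diagonal_mul, Matrix.mul_apply, map_sum, map_mul] at this
  rw [Matrix.diagonal_mul, Matrix.mul_apply]
  simpa [hU, embeddingPerm_apply] using this

theorem map_mem_conjDiagTorsion (hp : p ≠ 0) (σ : Gal(Qbar/k)) {g : GL (Fin n) Qbar}
    (hg : g ∈ conjDiagTorsion p (embeddingGL u τ)) :
    Matrix.GeneralLinearGroup.map (σ : Qbar →+* Qbar) g ∈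
      conjDiagTorsion p (embeddingGL u τ) := by
  obtain ⟨w, hw, h⟩ := (mem_conjDiagTorsion hp).1 hg
  refine (mem_conjDiagTorsion hp).2 ⟨_, fun i => ?_, map_mul_eq_diagonal_mul σ h⟩
  rw [← map_pow, hw, map_one]

/-- An automorphism fixing `U⁻¹ P U` entrywise fixes `ξ` and `L`: it fixes the matrix with a single
eigenvalue `ξ ≠ 1`, placed at the inclusion `L ⊆ Qbar`. -/
theorem fixes_of_forall_map_eq (hp : 1 < p) {ξ : Qbar} (hξ : IsPrimitiveRoot ξ p)
    {σ : Gal(Qbar/k)}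
    (hσ : ∀ g ∈ conjDiagTorsion p (embeddingGL u τ),
      Matrix.GeneralLinearGroup.map (σ : Qbar →+* Qbar) g = g) :
    σ ξ = ξ ∧ ∀ x ∈ L, σ x = x := by
  set U := embeddingGL u τ with hU
  obtain ⟨i, hi⟩ := τ.surjective L.val
  set w : Fin n → Qbar := Function.update 1 i ξ with hw
  have hwp (j) : w j ^ p = 1 := by
    by_cases hj : j = i
    · subst hj; simp [w, hξ.pow_eq_one]
    · simp [w, hj]
  have hdet : IsUnit (Matrix.diagonal w) :=
    Matrix.isUnit_diagonal.2 (IsUnit.of_pow_eq_one (funext hwp : w ^ p = 1) (by lia))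
  set g : GL (Fin n) Qbar := U⁻¹ * hdet.unit * U with hg
  have hUg : U.val * g.val = Matrix.diagonal w * U.val := by
    rw [← Units.val_mul, hg, mul_assoc, mul_inv_cancel_left]
    rfl
  have hgm : g ∈ conjDiagTorsion p U := (mem_conjDiagTorsion (by lia)).2 ⟨w, hwp, hUg⟩
  have h2 := map_mul_eq_diagonal_mul σ hUg
  rw [hσ g hgm, hUg] at h2
  have h3 := Matrix.diagonal_injective (U.isUnit.mul_right_cancel h2)
  have h4 : w (embeddingPerm τ σ i) = σ ξ := by
    rw [h3]; simp [w]
  have h5 : embeddingPerm τ σ i = i := by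
    by_contra hne
    have : σ ξ = 1 := by rw [← h4]; simp [w, hne]
    exact hξ.ne_one hp (by simpa using this)
  refine ⟨by rw [← h4, h5]; simp [w], fun x hx => ?_⟩
  have := embeddingPerm_apply τ σ i ⟨x, hx⟩
  rw [h5, hi] at this
  exact this.symm

end Action

/-! ### Adjoining the root of unity -/

section Roots

variable {K : IntermediateField ℚ Qbar} {ξ : Qbar} {p : ℕ}

theorem algEquiv_root_eq_pow {k : Type*} [Field k] [Algebra k Qbar] [NeZero p]
    (hξ : IsPrimitiveRoot ξ p) (σ : Gal(Qbar/k)) : ∃ a : ℕ, σ ξ = ξ ^ a := by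
  have : (σ ξ) ^ p = 1 := by rw [← map_pow, hξ.pow_eq_one, map_one]
  obtain ⟨a, -, ha⟩ := hξ.eq_pow_of_pow_eq_one this
  exact ⟨a, ha.symm⟩

theorem algEquiv_root_comm {k : Type*} [Field k] [Algebra k Qbar] [NeZero p]
    (hξ : IsPrimitiveRoot ξ p) (σ τ : Gal(Qbar/k)) {ζ : Qbar} (hζ : ζ ^ p = 1) :
    σ (τ ζ) = τ (σ ζ) := by
  obtain ⟨c, -, rfl⟩ := hξ.eq_pow_of_pow_eq_one hζ
  obtain ⟨a, ha⟩ := algEquiv_root_eq_pow hξ σ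
  obtain ⟨b, hb⟩ := algEquiv_root_eq_pow hξ τ
  simp only [map_pow, ha, hb, ← pow_mul]
  congr 1
  ring

theorem forall_mem_adjoinRoot_eq {σ : Gal(Qbar/K)} (h : σ ξ = ξ) {x : Qbar}
    (hx : x ∈ adjoinRoot K ξ) : σ x = x := by
  have h1 : adjoinRoot K ξ ≤ IntermediateField.fixedField (Subgroup.zpowers σ) := by
    rw [adjoinRoot, IntermediateField.adjoin_le_iff, Set.singleton_subset_iff]
    rintro ⟨s, hs⟩
    exact (Subgroup.zpowers_le (H := MulAction.stabilizer Gal(Qbar/K) ξ)).2 h hs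
  exact h1 hx ⟨σ, Subgroup.mem_zpowers σ⟩

theorem forall_mem_compositum_eq {L : IntermediateField K Qbar} {σ : Gal(Qbar/K)} (h : σ ξ = ξ)
    (hL : ∀ x ∈ L, σ x = x) {x : Qbar} (hx : x ∈ compositum L ξ) : σ x = x := by
  have h1 : compositum L ξ ≤ IntermediateField.fixedField (Subgroup.zpowers σ) := by
    refine sup_le ?_ ?_
    · rw [IntermediateField.le_iff_le, Subgroup.zpowers_le]
      exact (IntermediateField.mem_fixingSubgroup_iff L σ).2 hL
    · rw [IntermediateField.le_iff_le, Subgroup.zpowers_le]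
      exact (IntermediateField.mem_fixingSubgroup_iff _ σ).2 fun x => forall_mem_adjoinRoot_eq h
  exact h1 hx ⟨σ, Subgroup.mem_zpowers σ⟩

theorem mem_adjoinRoot_self : ξ ∈ adjoinRoot K ξ :=
  IntermediateField.mem_adjoin_simple_self K ξ

instance isGalois_Qbar : IsGalois K Qbar := by
  have : Algebra.IsAlgebraic K Qbar := Algebra.IsAlgebraic.tower_top (K := ℚ) K
  have : IsAlgClosure K Qbar := ⟨inferInstance, inferInstance⟩
  have := IsAlgClosure.normal K Qbar
  exact {}

instance isGalois_Qbar_adjoinRoot : IsGalois (adjoinRoot K ξ) Qbar :=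
  IsGalois.tower_top_of_isGalois K (adjoinRoot K ξ) Qbar

theorem normal_adjoinRoot [NeZero p] (hξ : IsPrimitiveRoot ξ p) : Normal K (adjoinRoot K ξ) := by
  rw [IntermediateField.normal_iff_forall_map_le']
  intro σ
  rw [adjoinRoot, IntermediateField.adjoin_map, Set.image_singleton,
    IntermediateField.adjoin_simple_le_iff]
  obtain ⟨a, ha⟩ := algEquiv_root_eq_pow hξ σ
  change σ ξ ∈ _
  rw [ha]
  exact pow_mem mem_adjoinRoot_self a

theorem isGalois_compositum [NeZero p] (hξ : IsPrimitiveRoot ξ p) (L : IntermediateField K Qbar)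
    [Normal K L] : IsGalois K (compositum L ξ) := by
  have := normal_adjoinRoot (K := K) hξ
  have : Normal K (compositum L ξ) := IntermediateField.normal_sup K Qbar L (adjoinRoot K ξ)
  exact {}

theorem isGalois_compositumOver [NeZero p] (hξ : IsPrimitiveRoot ξ p)
    (L : IntermediateField K Qbar) [Normal K L] :
    IsGalois (adjoinRoot K ξ) (compositumOver L ξ) := by
  have := isGalois_compositum hξ L
  have : Normal (adjoinRoot K ξ) (compositumOver L ξ) := by
    rw [IntermediateField.normal_iff_forall_map_le']
    rintro σ _ ⟨x, hx, rfl⟩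
    exact IntermediateField.normal_iff_forall_map_le'.1 (inferInstance : Normal K (compositum L ξ))
      (σ.restrictScalars K) ⟨x, hx, rfl⟩
  exact {}

variable {L : IntermediateField K Qbar} {n : ℕ}

/-- The entries of `U⁻¹ w U` are the sums `∑ₖ τ_k (y i) w_k τ_k (u j)`, with `y` the integral dual
basis, so they are integers of `L(ξ)`. -/
theorem entries_mem (hp : p ≠ 0) [NeZero p] (hξ : IsPrimitiveRoot ξ p) [NumberField K]
    [NumberField L] [Normal K L]
    (h : IsEverywhereUnramified K L) (u : Module.Basis (Fin n) (𝓞 K) (𝓞 L))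
    (τ : Fin n ≃ (L →ₐ[K] Qbar)) {g : GL (Fin n) Qbar}
    (hg : g ∈ conjDiagTorsion p (embeddingGL (integralBasisToField u) τ)) (i j : Fin n) :
    g.val i j ∈ compositum L ξ ∧ IsIntegral ℤ (g.val i j) := by
  obtain ⟨w, hw, hgw⟩ := (mem_conjDiagTorsion hp).1 hg
  obtain ⟨y, hy⟩ := exists_inv_embeddingGL h u τ
  have hval : g.val = (Matrix.of fun i j => τ j (y i)) *
      (Matrix.diagonal w * (embeddingGL (integralBasisToField u) τ).val) := by
    rw [← hgw, ← hy, ← Units.val_mul, ← Units.val_mul, inv_mul_cancel_left]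
  have hentry (k) : (embeddingGL (integralBasisToField u) τ).val k j = τ k (u j) := by
    rw [← integralBasisToField_apply]
    rfl
  have hL (k) (x : L) : τ k x ∈ compositum L ξ := by
    refine (le_sup_left : L ≤ compositum L ξ) ?_
    have : τ k x ∈ (τ k).fieldRange := ⟨x, rfl⟩
    rwa [AlgHom.fieldRange_of_normal] at this
  have hint (k) (x : 𝓞 L) : IsIntegral ℤ (τ k x) :=
    map_isIntegral_int (τ k).toRingHom x.isIntegral_coe
  rw [hval, Matrix.mul_apply]
  simp only [Matrix.diagonal_mul, Matrix.of_apply, hentry]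
  refine ⟨sum_mem fun k _ => mul_mem (hL _ _) (mul_mem ?_ (hL _ _)), IsIntegral.sum _ fun k _ =>
    (hint _ _).mul (IsIntegral.mul (IsIntegral.of_pow (Nat.pos_of_ne_zero hp) ?_) (hint _ _))⟩
  · obtain ⟨a, -, ha⟩ := hξ.eq_pow_of_pow_eq_one (hw k)
    rw [← ha]
    exact pow_mem ((le_sup_right : adjoinRoot K ξ ≤ compositum L ξ) mem_adjoinRoot_self) a
  · rw [hw]; exact isIntegral_one

theorem le_glIntegers {k : Type*} [Field k] [Algebra k Qbar] {F : IntermediateField k Qbar}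
    {G : Subgroup (GL (Fin n) Qbar)}
    (h : ∀ g ∈ G, ∀ i j, g.val i j ∈ F ∧ IsIntegral ℤ (g.val i j)) : G ≤ glIntegers n F := by
  intro g hg
  have key : ∀ x : Qbar, x ∈ F ∧ IsIntegral ℤ x →
      x ∈ ((algebraMap F Qbar).comp (algebraMap (𝓞 F) F)).range := fun x hx =>
    ⟨⟨⟨x, hx.1⟩, (isIntegral_algHom_iff ((algebraMap F Qbar).toIntAlgHom)
      (algebraMap F Qbar).injective).1 hx.2⟩, rfl⟩
  refine mem_range_map_of_entries ?_ (fun i j => key _ (h g hg i j))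
    fun i j => key _ (h g⁻¹ (inv_mem hg) i j)
  exact (algebraMap F Qbar).injective.comp NumberField.RingOfIntegers.coe_injective

theorem le_glField {k : Type*} [Field k] [Algebra k Qbar] {F : IntermediateField k Qbar}
    {G : Subgroup (GL (Fin n) Qbar)} (h : ∀ g ∈ G, ∀ i j, g.val i j ∈ F) : G ≤ glField n F := by
  intro g hg
  exact mem_range_map_of_entries (algebraMap F Qbar).injective (fun i j => ⟨⟨_, h g hg i j⟩, rfl⟩)
    fun i j => ⟨⟨_, h g⁻¹ (inv_mem hg) i j⟩, rfl⟩

end Roots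

section Galois

variable {K : IntermediateField ℚ Qbar} {ξ : Qbar} {p : ℕ} [NeZero p]
  {L : IntermediateField K Qbar} [Normal K L]

theorem restrictNormalHom_L_surjective :
    Function.Surjective (AlgEquiv.restrictNormalHom (F := K) (K₁ := Qbar) L) :=
  AlgEquiv.restrictNormalHom_surjective Qbar

theorem restrictNormalHom_eq_one_iff {k : Type*} [Field k] [Algebra k Qbar]
    {N : IntermediateField k Qbar} [Normal k N] {σ : Gal(Qbar/k)} :
    AlgEquiv.restrictNormalHom N σ = 1 ↔ ∀ x ∈ N, σ x = x := by
  rw [← MonoidHom.mem_ker, IntermediateField.restrictNormalHom_ker,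
    IntermediateField.mem_fixingSubgroup_iff]

/-- The absolute Galois group of `K(ξ)` still surjects onto a perfect `Gal(L/K)`, because
commutators of `Γ_K` fix `ξ`. -/
theorem restrict_surjective (hξ : IsPrimitiveRoot ξ p) (hperf : commutator Gal(L/K) = ⊤) :
    Function.Surjective ((AlgEquiv.restrictNormalHom (F := K) (K₁ := Qbar) L).comp
      (AlgEquiv.restrictScalarsHom K : Gal(Qbar/adjoinRoot K ξ) →* Gal(Qbar/K))) := by
  rw [← MonoidHom.range_eq_top, eq_top_iff, ← hperf, commutator_def, Subgroup.commutator_le]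
  intro a _ b _
  obtain ⟨s, rfl⟩ := restrictNormalHom_L_surjective (L := L) a
  obtain ⟨t, rfl⟩ := restrictNormalHom_L_surjective (L := L) b
  have hfix : s * t * s⁻¹ * t⁻¹ ∈ (adjoinRoot K ξ).fixingSubgroup := by
    refine (IntermediateField.mem_fixingSubgroup_iff _ _).2 fun x => forall_mem_adjoinRoot_eq ?_
    have h1 : (s⁻¹ (t⁻¹ ξ)) ^ p = 1 := by
      rw [← map_pow, ← map_pow, hξ.pow_eq_one, map_one, map_one]
    have h2 := algEquiv_root_comm hξ s t h1
    change s (t (s⁻¹ (t⁻¹ ξ))) = ξ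
    rw [h2]
    have h3 : (t * s * s⁻¹ * t⁻¹) ξ = ξ := by simp
    exact h3
  refine ⟨IntermediateField.fixingSubgroupEquiv _ ⟨_, hfix⟩, ?_⟩
  rw [← map_commutatorElement]
  rfl

/-- Restriction to `L(ξ)` and restriction to `L` are surjections from `Γ_{K(ξ)}` with the same
kernel. -/
theorem nonempty_gal_compositumOver_equiv (hξ : IsPrimitiveRoot ξ p)
    (hperf : commutator Gal(L/K) = ⊤) :
    Nonempty (Gal(compositumOver L ξ/adjoinRoot K ξ) ≃* Gal(L/K)) := by
  have := isGalois_compositumOver hξ L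
  have hker : (AlgEquiv.restrictNormalHom (F := adjoinRoot K ξ) (K₁ := Qbar)
      (compositumOver L ξ)).ker = ((AlgEquiv.restrictNormalHom (F := K) (K₁ := Qbar) L).comp
      (AlgEquiv.restrictScalarsHom K : Gal(Qbar/adjoinRoot K ξ) →* Gal(Qbar/K))).ker := by
    ext σ
    rw [MonoidHom.mem_ker, MonoidHom.mem_ker, MonoidHom.comp_apply, restrictNormalHom_eq_one_iff,
      restrictNormalHom_eq_one_iff]
    constructor
    · intro h x hx
      exact h x ((le_sup_left : L ≤ compositum L ξ) hx)
    · intro h x hx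
      refine forall_mem_compositum_eq (σ := σ.restrictScalars K) ?_ h hx
      exact σ.commutes ⟨ξ, mem_adjoinRoot_self⟩
  exact ⟨(QuotientGroup.quotientKerEquivOfSurjective _
    (AlgEquiv.restrictNormalHom_surjective Qbar)).symm.trans
    ((QuotientGroup.quotientMulEquivOfEq hker).trans
      (QuotientGroup.quotientKerEquivOfSurjective _ (restrict_surjective hξ hperf)))⟩

theorem not_commutative_compositum (hξ : IsPrimitiveRoot ξ p)
    (hL : ¬ ∀ a b : Gal(L/K), a * b = b * a) :
    ¬ ∀ a b : Gal(compositum L ξ/K), a * b = b * a := by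
  have := isGalois_compositum hξ L
  refine fun hcomm => hL fun a b => ?_
  obtain ⟨s, rfl⟩ := restrictNormalHom_L_surjective (L := L) a
  obtain ⟨t, rfl⟩ := restrictNormalHom_L_surjective (L := L) b
  have h1 := hcomm (AlgEquiv.restrictNormalHom (compositum L ξ) s)
    (AlgEquiv.restrictNormalHom (compositum L ξ) t)
  rw [← commutatorElement_eq_one_iff_mul_comm, ← map_commutatorElement,
    restrictNormalHom_eq_one_iff] at h1 ⊢
  exact fun x hx => h1 x ((le_sup_left : L ≤ compositum L ξ) hx)

end Galois

/-! ### The extensions with group `A₅` -/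

theorem commutator_eq_top_of_equiv {G H : Type*} [Group G] [Group H] (e : G ≃* H)
    (h : commutator H = ⊤) : commutator G = ⊤ := by
  rw [commutator_def] at h ⊢
  have := Subgroup.map_commutator ⊤ ⊤ e.symm.toMonoidHom
  rwa [h, Subgroup.map_top_of_surjective _ e.symm.surjective, eq_comm] at this

theorem not_commutative_of_equiv {G : Type*} [Group G] (e : G ≃* alternatingGroup (Fin 5)) :
    ¬ ∀ a b : G, a * b = b * a := by
  intro h
  have key : ∀ a b : alternatingGroup (Fin 5), a * b = b * a := fun a b => by
    simpa using congrArg e (h (e.symm a) (e.symm b))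
  have h1 := congrArg (fun x : alternatingGroup (Fin 5) => x.1 0) (key
    ⟨Equiv.swap 0 1 * Equiv.swap 1 2, Equiv.Perm.mem_alternatingGroup.2 (by decide)⟩
    ⟨Equiv.swap 0 1 * Equiv.swap 1 3, Equiv.Perm.mem_alternatingGroup.2 (by decide)⟩)
  revert h1
  decide

section Extension

variable {K : IntermediateField ℚ Qbar} {L : IntermediateField K Qbar}

theorem numberField_of_finiteDimensional [NumberField K] [FiniteDimensional K L] :
    NumberField L := by
  have : FiniteDimensional ℚ L := FiniteDimensional.trans ℚ K L
  -- `NumberField` refers to the canonical `ℚ`-algebra structure of a field of characteristic zero,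
  -- which agrees with the one coming from the tower.
  exact { to_finiteDimensional := by convert this }

theorem finrank_eq_sixty (h : IsUnramifiedTotallyRealA5 K L) : Module.finrank K L = 60 := by
  have := h.isGalois
  have := h.finiteDimensional
  obtain ⟨e⟩ := h.gal_equiv
  rw [← IsGalois.card_aut_eq_finrank, Nat.card_congr e.toEquiv]
  have := two_mul_nat_card_alternatingGroup (α := Fin 5)
  rw [Nat.card_perm, Nat.card_fin] at this
  have h5 : Nat.factorial 5 = 120 := rfl
  lia

theorem nonempty_embeddings (h : IsUnramifiedTotallyRealA5 K L) :
    Nonempty (Fin 60 ≃ (L →ₐ[K] Qbar)) := by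
  have := h.finiteDimensional
  refine ⟨(Fintype.equivFinOfCardEq ?_).symm⟩
  rw [AlgHom.card, finrank_eq_sixty h]

theorem nonempty_integralBasis [NumberField K] (hK : NumberField.classNumber K = 1)
    (h : IsUnramifiedTotallyRealA5 K L) : Nonempty (Module.Basis (Fin 60) (𝓞 K) (𝓞 L)) := by
  have := h.finiteDimensional
  have : NumberField L := numberField_of_finiteDimensional (K := K)
  have : IsPrincipalIdealRing (𝓞 K) := NumberField.classNumber_eq_one_iff.1 hK
  have : Module.Free (𝓞 K) (𝓞 L) := inferInstance
  let b := Module.Free.chooseBasis (𝓞 K) (𝓞 L)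
  have : IsLocalization (Algebra.algebraMapSubmonoid (𝓞 L) (nonZeroDivisors (𝓞 K))) L :=
    isLocalization_integers
  have hc := Module.finrank_eq_card_basis
    (b.localizationLocalization K (nonZeroDivisors (𝓞 K)) L)
  rw [finrank_eq_sixty h] at hc
  exact ⟨b.reindex (Fintype.equivFinOfCardEq hc.symm)⟩

end Extension

theorem exists_isUnramifiedTotallyRealA5 :
    ∃ L : IntermediateField quadField Qbar, IsUnramifiedTotallyRealA5 quadField L := by
  obtain ⟨δ, hδ, hK⟩ := exists_sqrt
  obtain ⟨v, hv⟩ := exists_isRootList_of_isAlgClosed Qbar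
  let L : IntermediateField quadField Qbar := IntermediateField.adjoin quadField (Set.range v)
  have hmem (i) : v i ∈ L := IntermediateField.subset_adjoin _ _ ⟨i, rfl⟩
  let w : Fin 5 → L := fun i => ⟨v i, hmem i⟩
  have hw : IsRootList w := IsRootList.of_map _ (algebraMap L Qbar).injective hv
  have : FiniteDimensional quadField L :=
    IntermediateField.finiteDimensional_adjoin fun x _ =>
      (Algebra.IsAlgebraic.isAlgebraic (R := quadField) x).isIntegral
  have : NumberField L := numberField_of_finiteDimensional (K := quadField)
  refine ⟨L, isUnramifiedTotallyRealA5_of_isRootList hw ?_ hδ hK⟩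
  apply IntermediateField.lift_injective L
  rw [IntermediateField.lift_adjoin, IntermediateField.lift_top, ← Set.range_comp]
  rfl

end StableGL

end

theorem mainTheorem2 :
    NumberField.classNumber StableGL.quadField = 1 ∧
    (∃ L : IntermediateField StableGL.quadField StableGL.Qbar,
      StableGL.IsUnramifiedTotallyRealA5 StableGL.quadField L) ∧
    ∀ L : IntermediateField StableGL.quadField StableGL.Qbar,
      StableGL.IsUnramifiedTotallyRealA5 StableGL.quadField L →
      Nonempty (Module.Basis (Fin 60) (𝓞 StableGL.quadField) (𝓞 L)) ∧
      Nonempty (Fin 60 ≃ (L →ₐ[StableGL.quadField] StableGL.Qbar)) ∧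
      ∀ (u : Module.Basis (Fin 60) (𝓞 StableGL.quadField) (𝓞 L))
        (τ : Fin 60 ≃ (L →ₐ[StableGL.quadField] StableGL.Qbar))
        (p : ℕ) (_hp : p.Prime) (ξ : StableGL.Qbar) (_hξ : IsPrimitiveRoot ξ p)
        (P_U : Subgroup (GL (Fin 60) StableGL.Qbar))
        (_hP_U : P_U = StableGL.conjDiagTorsion p
          (StableGL.embeddingGL (StableGL.integralBasisToField u) τ)),
        -- `P_U` is a finite `Γ_K`-stable subgroup of `GL_60` of the integers of `L(ξ)`
        (P_U : Set (GL (Fin 60) StableGL.Qbar)).Finite ∧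
        StableGL.IsGaloisStable StableGL.quadField P_U ∧
        P_U ≤ StableGL.glIntegers 60 (StableGL.compositum L ξ) ∧
        -- its field of definition over `K` is `L(ξ)`, which is not abelian over `K`
        StableGL.IsFieldOfDefinition StableGL.quadField P_U (StableGL.compositum L ξ) ∧
        (¬ ∀ a b : Gal(StableGL.compositum L ξ/StableGL.quadField), a * b = b * a) ∧
        -- over `K(ξ)` it is again `L(ξ)`, with Galois group `A₅`
        StableGL.IsGaloisStable (StableGL.adjoinRoot StableGL.quadField ξ) P_U ∧
        StableGL.IsFieldOfDefinition (StableGL.adjoinRoot StableGL.quadField ξ) P_U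
          (StableGL.compositumOver L ξ) ∧
        Nonempty (Gal(StableGL.compositumOver L ξ/StableGL.adjoinRoot StableGL.quadField ξ) ≃*
          alternatingGroup (Fin 5)) := by
  refine ⟨StableGL.classNumber_quadField, StableGL.exists_isUnramifiedTotallyRealA5, fun L h =>
    ⟨StableGL.nonempty_integralBasis StableGL.classNumber_quadField h,
      StableGL.nonempty_embeddings h, ?_⟩⟩
  rintro u τ p hp ξ hξ _ rfl
  have := h.isGalois
  have := h.finiteDimensional
  have : NumberField L := StableGL.numberField_of_finiteDimensional (K := StableGL.quadField)
  have : NeZero p := ⟨hp.ne_zero⟩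
  obtain ⟨e⟩ := h.gal_equiv
  have hperf : commutator Gal(L/StableGL.quadField) = ⊤ :=
    StableGL.commutator_eq_top_of_equiv e (commutator_alternatingGroup_eq_top (by simp))
  have hent := fun g hg i j =>
    StableGL.entries_mem (L := L) hp.ne_zero hξ h.unramified u τ (g := g) hg i j
  refine ⟨StableGL.finite_conjDiagTorsion hp.ne_zero _,
    StableGL.isGaloisStable_of_forall_mem fun σ g hg =>
      StableGL.map_mem_conjDiagTorsion hp.ne_zero σ hg,
    StableGL.le_glIntegers hent,
    StableGL.isFieldOfDefinition_of_forall (StableGL.isGalois_compositum hξ L)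
      (StableGL.le_glField fun g hg i j => (hent g hg i j).1) fun σ hσ x hx => ?_,
    StableGL.not_commutative_compositum hξ (StableGL.not_commutative_of_equiv e),
    StableGL.isGaloisStable_of_forall_mem fun σ g hg =>
      StableGL.map_mem_conjDiagTorsion hp.ne_zero (σ.restrictScalars StableGL.quadField) hg,
    StableGL.isFieldOfDefinition_of_forall (StableGL.isGalois_compositumOver hξ L)
      (StableGL.le_glField fun g hg i j => (hent g hg i j).1) fun σ hσ x hx => ?_,
    (StableGL.nonempty_gal_compositumOver_equiv hξ hperf).map fun f => f.trans e⟩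
  · obtain ⟨h1, h2⟩ := StableGL.fixes_of_forall_map_eq hp.one_lt hξ hσ
    exact StableGL.forall_mem_compositum_eq h1 h2 hx
  -- An automorphism over `K(ξ)` is in particular one over `K`.
  · obtain ⟨h1, h2⟩ := StableGL.fixes_of_forall_map_eq
      (σ := σ.restrictScalars StableGL.quadField) hp.one_lt hξ hσ
    exact StableGL.forall_mem_compositum_eq (σ := σ.restrictScalars StableGL.quadField) h1 h2 hx
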